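/- **Setting.** Let $X$ be a measurable space and $H$ a family of binary classifiers on $X$, with a query set $Q$ of finitely many oracles; oracle $i$ assigns to $h\in H$ and a tuple $T$ of $k_i$ points a nonempty set $\mathcal O_i(h,T)\subseteq[r_i]$ of valid answers. For a finite sample $S$ (a sequence of points), $q(S)\in Q_h(S)$ denotes a choice of one valid answer under $h$ to every query on points of $S$, and $q(S)|_W$ its restriction to a subsample $W$. $I(q(S))$ is the set of points on whose label all hypotheses consistent with $q(S)$ agree. An inference rule $R$ assigns to every response $q(S)$ a set $S\subseteq I_R(q(S))\subseteq I(q(S))$ with $I_R(q(S)|_{W})\subseteq I_R(q(S))$ for every subsample $W$ of $S$. A lossless compression scheme (LCS) of size $k\ge 1$ with respect to $Q$ and $R$ assigns to every $h\in H$, every finite sample $S$ on which $h$ is constant and every $q(S)\in Q_h(S)$ a subset $W=W(q(S))$ of $S$ with $|W|\le k$ and $I_R(q(S)|_W)=I_R(q(S))$. **Machines.** A computation works on points on a query tape and bits on a work tape. It reads bits, asks queries about points on the query tape (one unit of time each), and evaluates measurable predicates of finitely many points on the query tape, at a cost in $[0,\infty]$ given by an arbitrary cost model ($\infty$: predicate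 not available); returning costs one unit. A learner is deterministic and non-uniform. In each step it performs a computation, which may depend on the lengths of the tapes and on two counters (points drawn, queries made), and then carries out a list of operations, at one unit each: draw the next point of the stream onto the query tape, remove a point from it, exchange two points on it, append or delete a bit at the end of the work tape. Nothing but the tapes and the counters is kept from one step to the next. The tapes at the end determine a classifier $X\to\{0,1,\bot\}$. The memory is the maximal length of the two tapes over the whole run; the counters are not charged. Besides $h$ and the distribution $D$, the adversary chooses one valid answer to each possible query before the points are drawn. A learner *actively RPU-learns* $(X,H)$ with parameters $\varepsilon,\delta$ if, for every $h\in H$ and all valid answers, it always halts; it is reliable: on every stream, every label it outputs agrees with $h$; and, if the answers are measurable functions of the queried points, it is probably useful: for every distribution $D$ on $X$ and i.i.d. points from $D$, the probability that $\Pr_{x\sim D}[\text{output at }x\text{ is }\bot]>\varepsilon$ is less than $\delta$. **Complexities.** Fix a binary encoding of query responses that expresses $q(S)$ with $|S|=n$ by a number of bits that depends on $n$ only and is at least one, and let $B(n)$ be the largest number of bits for $|S|\le n$. Fix procedures (a) that infer, by queries on a sample $S$, a valid response $q(S)$ and write its encoding, such that for fixed $h$ and fixed answers the responses reported on all samples of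 the same size are restrictions of one valid choice of answers to all queries; $b(n)$ is the worst-case number of queries and $t(n)$ the worst-case time, including one unit for each bit written; (b) that determine $W(q(S))$ from a sample $S$ on which $h$ is constant and the encoding of $q(S)$, without queries, in worst-case time $T_C(n)$; (c) that, given $S$, the encoding of $q(S)$ and $x\in X$, determine without queries whether $x\in I_R(q(S))$ and, if so, the label of $x$, in worst-case time $T_{I_R}(n)$. All worst cases are over $h\in H$, valid answers, $|S|\le n$ and $x\in X$, and may be infinite. **Theorem (Bounded Memory Active Learning).** There is an absolute constant $C>0$ such that the following holds. Let $(X,H)$ have an LCS of size $k\ge1$ with respect to the query set $Q$ and the inference rule $R$, with an encoding, a cost model and procedures as above. Then for all $\varepsilon,\delta\in(0,1)$ there is a learner that actively RPU-learns $(X,H)$ with parameters $\varepsilon,\delta$ and that, for every $h\in H$, all valid answers and every stream of points, makes at most $$C\, b(6k)\,\log\tfrac{2}{\varepsilon\delta}$$ queries, never has more than $7k$ points on the query tape and $C\,B(7k)$ bits on the work tape (independently of $\varepsilon$ and $\delta$), and runs in time at most $$C\left(t(7k)+T_C(7k)+\frac{k\,T_{I_R}(k)\,\log(2k/(\varepsilon\delta))}{\varepsilon}\right)\log\tfrac{2}{\varepsilon\delta}.$$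 -/

import Mathlib

open MeasureTheory
open scoped ENNReal

universe u v

noncomputable section

/-! ### Hypothesis classes with enriched queries -/

/-- A hypothesis class `(X, H)` of binary classifiers together with a finite query set.
Oracle `i` takes `inputs i` points and has possible answers `{0, …, arity i - 1}`;
`valid i h T` is the nonempty set of valid answers to the query `T` under the hypothesis `h`. -/
structure QueryClass (X : Type u) where
  Hyp : Type v
  label : Hyp → X → Bool
  num : ℕ
  inputs : Fin num → ℕ
  arity : Fin num → ℕ
  valid : (i : Fin num) → Hyp → (Fin (inputs i) → X) → Set (Fin (arity i))
  valid_nonempty : ∀ i h T, (valid i h T).Nonempty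

namespace QueryClass

variable {X : Type u}

/-- A choice of one answer to every possible query. -/
abbrev Answers (Q : QueryClass.{u, v} X) : Type u :=
  (i : Fin Q.num) → (Fin (Q.inputs i) → X) → Fin (Q.arity i)

/-- Every chosen answer is valid under `h`. -/
def IsValid (Q : QueryClass.{u, v} X) (h : Q.Hyp) (a : Q.Answers) : Prop :=
  ∀ i T, a i T ∈ Q.valid i h T

/-- One answer to every query on the points of a sample with `n` entries. A sample is a finite
sequence of points, so that repetitions are allowed, and queries are addressed by positions. -/
abbrev Table (Q : QueryClass.{u, v} X) (n : ℕ) : Type :=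
  (i : Fin Q.num) → (Fin (Q.inputs i) → Fin n) → Fin (Q.arity i)

/-- The restriction of `a` to the queries on the sample `S`. -/
def table (Q : QueryClass.{u, v} X) (a : Q.Answers) {n : ℕ} (S : Fin n → X) : Q.Table n :=
  fun i s => a i (S ∘ s)

/-- The restriction of a table to the queries on the subsample with positions `ρ`. -/
def restrict (Q : QueryClass.{u, v} X) {m n : ℕ} (ρ : Fin m → Fin n) (q : Q.Table n) :
    Q.Table m :=
  fun i s => q i (ρ ∘ s)

/-- `Q_h(S)`: the product of the sets of valid responses to all queries on `S`. -/
def responses (Q : QueryClass.{u, v} X) (h : Q.Hyp) {n : ℕ} (S : Fin n → X) : Set (Q.Table n) :=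
  {q | ∃ a, Q.IsValid h a ∧ q = Q.table a S}

/-- `I(q(S))`: the points whose label is the same for all hypotheses consistent with `q(S)`. -/
def inferred (Q : QueryClass.{u, v} X) {n : ℕ} (S : Fin n → X) (q : Q.Table n) : Set X :=
  {x | ∃ z : Bool, ∀ h', q ∈ Q.responses h' S → Q.label h' x = z}

end QueryClass

variable {X : Type u}

/-- An inference rule `R`: a set `S ⊆ I_R(q(S)) ⊆ I(q(S))` for every query response `q(S)`, where
passing to a subsample, and to the response restricted to it, never enlarges the set. (The last
condition implies that `I_R` does not depend on the order and the repetitions in a sample.) -/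
structure InferenceRule (Q : QueryClass.{u, v} X) where
  infer : (n : ℕ) → (Fin n → X) → Q.Table n → Set X
  mem_infer : ∀ (h : Q.Hyp) (n : ℕ) (S : Fin n → X), ∀ q ∈ Q.responses h S, ∀ j : Fin n,
    S j ∈ infer n S q
  infer_subset : ∀ (h : Q.Hyp) (n : ℕ) (S : Fin n → X), ∀ q ∈ Q.responses h S,
    infer n S q ⊆ Q.inferred S q
  mono : ∀ (h : Q.Hyp) (n : ℕ) (S : Fin n → X), ∀ q ∈ Q.responses h S,
    ∀ (m : ℕ) (ρ : Fin m → Fin n), infer m (S ∘ ρ) (Q.restrict ρ q) ⊆ infer n S q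

/-- All points of the sample have the same label under `h`. -/
def Monochromatic (Q : QueryClass.{u, v} X) (h : Q.Hyp) {n : ℕ} (S : Fin n → X) : Prop :=
  ∃ z : Bool, ∀ j, Q.label h (S j) = z

/-- A lossless compression scheme of size `k` with respect to the query set of `Q` and the
inference rule `R`: the subset `W(q(S))` of `S` is given by the list of its positions. -/
structure LosslessCompression {Q : QueryClass.{u, v} X} (R : InferenceRule Q) (k : ℕ) where
  W : (n : ℕ) → (Fin n → X) → Q.Table n → List (Fin n)
  length_le : ∀ (h : Q.Hyp) (n : ℕ) (S : Fin n → X), Monochromatic Q h S →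
    ∀ q ∈ Q.responses h S, (W n S q).length ≤ k
  lossless : ∀ (h : Q.Hyp) (n : ℕ) (S : Fin n → X), Monochromatic Q h S →
    ∀ q ∈ Q.responses h S,
      R.infer n S q = R.infer _ (S ∘ (W n S q).get) (Q.restrict (W n S q).get q)

/-- A binary encoding of query responses: `q(S)` for a sample with `n` entries is expressed by
`bits n ≥ 1` bits, and different responses are expressed differently. -/
structure ResponseEncoding (Q : QueryClass.{u, v} X) where
  bits : ℕ → ℕ
  bits_pos : ∀ n, 1 ≤ bits n
  enc : (n : ℕ) → Q.Table n → List Bool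
  length_enc : ∀ n q, (enc n q).length = bits n
  injOn : ∀ n, Set.InjOn (enc n) {q | ∃ (h : Q.Hyp) (S : Fin n → X), q ∈ Q.responses h S}

/-- `B(n)`: the number of bits that express any `q(S)` for samples with at most `n` entries. -/
def ResponseEncoding.maxBits {Q : QueryClass.{u, v} X} (E : ResponseEncoding Q) (n : ℕ) : ℕ :=
  (Finset.range (n + 1)).sup E.bits

/-! ### Computations and their cost -/

/-- The cost of evaluating a predicate of `m` points; `∞` means that the predicate is not
available to the machine. -/
abbrev CostModel (X : Type u) : Type u := (m : ℕ) → Set (Fin m → X) → ℝ≥0∞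

/-- A (non-uniform) computation on a query tape that holds `n` points and on a work tape: it
reads bits of the work tape, evaluates measurable predicates of points on the query tape, asks
queries about points on the query tape, and finally returns an element of `α`. -/
inductive TapeComputation [MeasurableSpace X] (Q : QueryClass.{u, v} X) (n : ℕ) (α : Type) : Type u
  | ret (r : α) : TapeComputation Q n α
  | readBit (j : ℕ) (next : Bool → TapeComputation Q n α) : TapeComputation Q n α
  | test (m : ℕ) (s : Set (Fin m → X)) (hs : MeasurableSet s) (pos : Fin m → Fin n)
      (next : Bool → TapeComputation Q n α) : TapeComputation Q n α
  | query (i : Fin Q.num) (pos : Fin (Q.inputs i) → Fin n)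
      (next : Fin (Q.arity i) → TapeComputation Q n α) : TapeComputation Q n α

namespace TapeComputation

variable [MeasurableSpace X] {Q : QueryClass.{u, v} X} {n : ℕ} {α : Type}

/-- The result, with points `p` on the query tape, bits `w` on the work tape (blank cells read as
`false`), and queries answered according to `a`. -/
def eval (p : Fin n → X) (w : List Bool) (a : Q.Answers) : TapeComputation Q n α → α
  | ret r => r
  | readBit j next => (next (w.getD j false)).eval p w a
  | test _ s _ pos next => (next (open Classical in decide (p ∘ pos ∈ s))).eval p w a
  | query i pos next => (next (a i (p ∘ pos))).eval p w a

/-- The running time: one unit for reading a bit, for asking a query and for returning, and the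
cost given by the cost model for evaluating a predicate. -/
def time (cost : CostModel X) (p : Fin n → X) (w : List Bool) (a : Q.Answers) :
    TapeComputation Q n α → ℝ≥0∞
  | ret _ => 1
  | readBit j next => 1 + (next (w.getD j false)).time cost p w a
  | test m s _ pos next =>
      cost m s + (next (open Classical in decide (p ∘ pos ∈ s))).time cost p w a
  | query i pos next => 1 + (next (a i (p ∘ pos))).time cost p w a

/-- The number of queries that are asked. -/
def queries (p : Fin n → X) (w : List Bool) (a : Q.Answers) : TapeComputation Q n α → ℕ
  | ret _ => 0
  | readBit j next => (next (w.getD j false)).queries p w a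
  | test _ s _ pos next => (next (open Classical in decide (p ∘ pos ∈ s))).queries p w a
  | query i pos next => 1 + (next (a i (p ∘ pos))).queries p w a

/-- The computation never asks a query. -/
def QueryFree : TapeComputation Q n α → Prop
  | ret _ => True
  | readBit _ next => ∀ b, (next b).QueryFree
  | test _ _ _ _ next => ∀ b, (next b).QueryFree
  | query _ _ _ => False

end TapeComputation

variable [MeasurableSpace X]

/-- A procedure that infers from queries on a sample `S` a valid response `q(S) ∈ Q_h(S)` to all
queries on `S` and writes down its encoding. For given `h` and given answers `a` to the queries
asked, the responses reported on all samples of the same size are restrictions of one choice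
`a'` of valid answers. -/
structure QueryProcedure {Q : QueryClass.{u, v} X} (E : ResponseEncoding Q) where
  prog : (n : ℕ) → TapeComputation Q n (List Bool)
  correct : ∀ (n : ℕ) (h : Q.Hyp) (a : Q.Answers), Q.IsValid h a →
    ∃ a', Q.IsValid h a' ∧ ∀ S : Fin n → X, (prog n).eval S [] a = E.enc n (Q.table a' S)

/-- `b(n)`: the worst-case number of queries on samples with at most `n` entries. -/
def QueryProcedure.numQueries {Q : QueryClass.{u, v} X} {E : ResponseEncoding Q}
    (P : QueryProcedure E) (n : ℕ) : ℝ≥0∞ :=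
  ⨆ (m : ℕ) (_ : m ≤ n) (h : Q.Hyp) (a : Q.Answers) (_ : Q.IsValid h a) (S : Fin m → X),
    ((P.prog m).queries S [] a : ℝ≥0∞)

/-- `t(n)`: the worst-case time, including one unit per bit of the response written, on samples
with at most `n` entries. -/
def QueryProcedure.worstTime {Q : QueryClass.{u, v} X} {E : ResponseEncoding Q}
    (P : QueryProcedure E) (cost : CostModel X) (n : ℕ) : ℝ≥0∞ :=
  ⨆ (m : ℕ) (_ : m ≤ n) (h : Q.Hyp) (a : Q.Answers) (_ : Q.IsValid h a) (S : Fin m → X),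
    ((P.prog m).time cost S [] a + (E.bits m : ℝ≥0∞))

/-- A procedure that determines `W(q(S))` from the points of a monochromatic sample `S` and the
encoding of `q(S)`. -/
structure CompressionProcedure {Q : QueryClass.{u, v} X} {R : InferenceRule Q} {k : ℕ}
    (W : LosslessCompression R k) (E : ResponseEncoding Q) where
  prog : (n : ℕ) → TapeComputation Q n (List (Fin n))
  queryFree : ∀ n, (prog n).QueryFree
  correct : ∀ (n : ℕ) (h : Q.Hyp) (a : Q.Answers) (S : Fin n → X), Q.IsValid h a →
    Monochromatic Q h S →
    (prog n).eval S (E.enc n (Q.table a S)) a = W.W n S (Q.table a S)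

/-- `T_C(n)`: the worst-case time for samples with at most `n` entries. -/
def CompressionProcedure.worstTime {Q : QueryClass.{u, v} X} {R : InferenceRule Q} {k : ℕ}
    {W : LosslessCompression R k} {E : ResponseEncoding Q} (K : CompressionProcedure W E)
    (cost : CostModel X) (n : ℕ) : ℝ≥0∞ :=
  ⨆ (m : ℕ) (_ : m ≤ n) (h : Q.Hyp) (a : Q.Answers) (_ : Q.IsValid h a) (S : Fin m → X)
    (_ : Monochromatic Q h S), (K.prog m).time cost S (E.enc m (Q.table a S)) a

open Classical in
/-- A procedure that, given the points of a sample `S`, the encoding of `q(S)` and a further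
point `x`, determines whether `x ∈ I_R(q(S))` and, if so, the inferred label of `x`. -/
structure InferenceProcedure {Q : QueryClass.{u, v} X} (R : InferenceRule Q)
    (E : ResponseEncoding Q) where
  prog : (n : ℕ) → TapeComputation Q (n + 1) (Option Bool)
  queryFree : ∀ n, (prog n).QueryFree
  correct : ∀ (n : ℕ) (h : Q.Hyp) (a : Q.Answers) (S : Fin n → X) (x : X), Q.IsValid h a →
    (prog n).eval (Fin.snoc S x) (E.enc n (Q.table a S)) a =
      if x ∈ R.infer n S (Q.table a S) then some (Q.label h x) else none

/-- `T_{I_R}(n)`: the worst-case time for samples with at most `n` entries. -/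
def InferenceProcedure.worstTime {Q : QueryClass.{u, v} X} {R : InferenceRule Q}
    {E : ResponseEncoding Q} (J : InferenceProcedure R E) (cost : CostModel X) (n : ℕ) : ℝ≥0∞ :=
  ⨆ (m : ℕ) (_ : m ≤ n) (h : Q.Hyp) (a : Q.Answers) (_ : Q.IsValid h a) (S : Fin m → X) (x : X),
    (J.prog m).time cost (Fin.snoc S x) (E.enc m (Q.table a S)) a

/-! ### Learners with a query tape, a work tape, a sample counter and a query counter -/

/-- The operations on the tapes: draw a point from the stream and append it to the query tape,
remove the point at a position of the query tape, exchange the points at two positions, append a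
bit to the work tape, remove the last bit of the work tape. -/
inductive TapeAction
  | sample
  | forget (j : ℕ)
  | swap (i j : ℕ)
  | write (b : Bool)
  | erase

/-- A deterministic active learner. In every step it carries out a computation, which may depend
on the lengths of the tapes and on the contents of the sample and the query counter and whose
intermediate results are then lost; the computation returns a list of operations on the tapes to
be carried out, or `none` in order to halt. After halting, the contents of the tapes determine
the classifier, where `none` is the answer "I don't know". -/
structure Learner (Q : QueryClass.{u, v} X) where
  step : (points bits samples queries : ℕ) → TapeComputation Q points (Option (List TapeAction))
  out : List X → List Bool → X → Option Bool

/-- The tapes and the counters of a learner, together with its running time so far and the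
maximal lengths of the two tapes so far. -/
structure LearnerState (X : Type u) where
  points : List X
  bits : List Bool
  samples : ℕ
  queries : ℕ
  time : ℝ≥0∞
  peakPoints : ℕ
  peakBits : ℕ
  halted : Bool

namespace LearnerState

/-- Both tapes are empty, and nothing has happened. -/
def start (X : Type u) : LearnerState X := ⟨[], [], 0, 0, 0, 0, 0, false⟩

/-- The effect of an operation on the tapes and the sample counter, for the stream `ω`. -/
def act (ω : ℕ → X) (s : LearnerState X) : TapeAction → LearnerState X
  | .sample => { s with points := s.points ++ [ω s.samples], samples := s.samples + 1 }
  | .forget j => { s with points := s.points.eraseIdx j }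
  | .swap i j =>
      match s.points[i]?, s.points[j]? with
      | some x, some y => { s with points := (s.points.set i y).set j x }
      | _, _ => s
  | .write b => { s with bits := s.bits ++ [b] }
  | .erase => { s with bits := s.bits.dropLast }

/-- Carry out an operation, in one unit of time, and update the maximal lengths of the tapes. -/
def perform (ω : ℕ → X) (s : LearnerState X) (o : TapeAction) : LearnerState X :=
  let s' := s.act ω o
  { s' with
    time := s'.time + 1
    peakPoints := max s'.peakPoints s'.points.length
    peakBits := max s'.peakBits s'.bits.length }

end LearnerState

namespace Learner

variable {Q : QueryClass.{u, v} X}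

/-- One step of the learner `A`, when queries are answered according to `a` and the unlabeled
points are drawn from the stream `ω`. -/
def next (A : Learner Q) (cost : CostModel X) (a : Q.Answers) (ω : ℕ → X) (s : LearnerState X) :
    LearnerState X :=
  if s.halted then s else
    let c := A.step s.points.length s.bits.length s.samples s.queries
    let s' : LearnerState X :=
      { s with
        queries := s.queries + c.queries s.points.get s.bits a
        time := s.time + c.time cost s.points.get s.bits a }
    match c.eval s.points.get s.bits a with
    | none => { s' with halted := true }
    | some l => l.foldl (LearnerState.perform ω) s'

/-- The state after `N` steps. -/
def state (A : Learner Q) (cost : CostModel X) (a : Q.Answers) (ω : ℕ → X) (N : ℕ) :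
    LearnerState X :=
  (A.next cost a ω)^[N] (LearnerState.start X)

/-- The learner halts. -/
def Halts (A : Learner Q) (cost : CostModel X) (a : Q.Answers) (ω : ℕ → X) : Prop :=
  ∃ N, (A.state cost a ω N).halted = true

/-- The state in which the learner halts (if it does). -/
def final (A : Learner Q) (cost : CostModel X) (a : Q.Answers) (ω : ℕ → X) : LearnerState X :=
  A.state cost a ω (sInf {N | (A.state cost a ω N).halted = true})

/-- The classifier that is returned. -/
def classifier (A : Learner Q) (cost : CostModel X) (a : Q.Answers) (ω : ℕ → X) :
    X → Option Bool :=
  A.out (A.final cost a ω).points (A.final cost a ω).bits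

/-- `A` actively RPU-learns the class with parameters `ε` and `δ`: for every hypothesis `h` and
every valid choice `a` of answers to the queries, it always halts, it is reliable on every stream,
and, if `a` is measurable, it is probably useful for every distribution `D`. -/
def IsRPULearner (A : Learner Q) (cost : CostModel X) (ε δ : ℝ) : Prop :=
  ∀ (h : Q.Hyp) (a : Q.Answers), Q.IsValid h a →
    (∀ ω, A.Halts cost a ω) ∧
    (∀ ω x z, A.classifier cost a ω x = some z → z = Q.label h x) ∧
    ((∀ i, Measurable (a i)) → ∀ D : Measure X, IsProbabilityMeasure D →
      Measure.infinitePi (fun _ : ℕ => D)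
        {ω | ENNReal.ofReal ε < D {x | A.classifier cost a ω x = none}} < ENNReal.ofReal δ)

end Learner

end

/-! Call a point covered by a sample if it is inferred from the sample points of one label. In each
of `T` rounds the learner replaces its sample by two subsamples, one for each label, with at most
`k` points each and with the same covered set `F` (lossless compression applies because each class
is monochromatic). It then adds `4 k` points by rejection sampling: from each block of `L ≥ 2 / ε`
draws it keeps the first point outside `F`, or the last draw if there is none. Coverage never
shrinks, and the space needed does not depend on `ε` and `δ`.

Progress comes from a leave-one-out argument (`card_not_covered_le`, `lintegral_compl_le`). Among `4
k + 1` independent kept points at most `2 k` are not covered by the rest, since such a point must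
belong to the compressed sample of its own label. By exchangeability the expected mass missed after
`4 k` kept points, measured in the law of a kept point, is at most `2 k / (4 k + 1) < 1 / 2`.
Outside `F` this law is a multiple of `D` (`candidateLaw_of_disjoint`), and it gives mass at least
`2 / 3` to the complement of `F` while `D Fᶜ > ε`. Hence the expected uncovered `D`-mass drops to at
most `3 / 4` of `D Fᶜ` (`lintegral_candidateLaw_le`). Counting the mass as zero once it is at most
`ε` (`excess`) makes this contraction unconditional, and Markov's inequality after `T = ⌈4 log (2 /
(ε δ))⌉` rounds gives usefulness.

Only tapes and counters survive a step. Every step before halting draws exactly one point, so the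
sample counter serves as a clock from which the phase of the algorithm is read off. The work tape
holds the responses on the selected points, so that queries are asked only in the `T + 1` updates.
`runsTo_round` and `rpuLearner_outcome` identify the run with the recursion `roundSample`, to which
the probabilistic argument applies.

Labels, reported responses and inferred sets are not assumed measurable. They are computed by
finitely branching trees of measurable tests and queries (`measurableSet_eval`), and the selection
process is tracked through stream positions, which are countable. -/

namespace TapeComputation

variable {X : Type u} [MeasurableSpace X] {Q : QueryClass.{u, v} X} {n n' : ℕ} {α β : Type}

/-! ### Combining computations -/

/-- Sequential composition. -/
def bind : TapeComputation Q n α → (α → TapeComputation Q n β) → TapeComputation Q n β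
  | ret r, f => f r
  | readBit j next, f => readBit j fun b => (next b).bind f
  | test m s hs pos next, f => test m s hs pos fun b => (next b).bind f
  | query i pos next, f => query i pos fun r => (next r).bind f

/-- Run a computation on the points at the positions `g` of a longer query tape. -/
def onPositions (g : Fin n → Fin n') : TapeComputation Q n α → TapeComputation Q n' α
  | ret r => ret r
  | readBit j next => readBit j fun b => (next b).onPositions g
  | test m s hs pos next => test m s hs (g ∘ pos) fun b => (next b).onPositions g
  | query i pos next => query i (g ∘ pos) fun r => (next r).onPositions g

/-- Run a computation with known bits in place of the contents of the work tape. -/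
def feed (w : List Bool) : TapeComputation Q n α → TapeComputation Q n α
  | ret r => ret r
  | readBit j next => (next (w.getD j false)).feed w
  | test m s hs pos next => test m s hs pos fun b => (next b).feed w
  | query i pos next => query i pos fun r => (next r).feed w

/-- Run a computation on the section of the work tape with the given offset and length. -/
def window (o len : ℕ) : TapeComputation Q n α → TapeComputation Q n α
  | ret r => ret r
  | readBit j next =>
      if j < len then readBit (o + j) fun b => (next b).window o len
      else (next false).window o len
  | test m s hs pos next => test m s hs pos fun b => (next b).window o len
  | query i pos next => query i pos fun r => (next r).window o len

variable (cost : CostModel X) (p : Fin n → X) (w : List Bool) (a : Q.Answers)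

theorem eval_bind (c : TapeComputation Q n α) (f : α → TapeComputation Q n β) :
    (c.bind f).eval p w a = (f (c.eval p w a)).eval p w a := by
  induction c with
  | ret r => rfl
  | readBit j next ih => exact ih _
  | test m s hs pos next ih => exact ih _
  | query i pos next ih => exact ih _

theorem time_bind_le (c : TapeComputation Q n α) (f : α → TapeComputation Q n β) :
    (c.bind f).time cost p w a ≤ c.time cost p w a + (f (c.eval p w a)).time cost p w a := by
  induction c with
  | ret r => exact le_add_self
  | readBit j next ih => simp only [bind, time, eval, add_assoc]; gcongr; exact ih _
  | test m s hs pos next ih => simp only [bind, time, eval, add_assoc]; gcongr; exact ih _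
  | query i pos next ih => simp only [bind, time, eval, add_assoc]; gcongr; exact ih _

theorem queries_bind (c : TapeComputation Q n α) (f : α → TapeComputation Q n β) :
    (c.bind f).queries p w a = c.queries p w a + (f (c.eval p w a)).queries p w a := by
  induction c with
  | ret r => simp [bind, queries, eval]
  | readBit j next ih => exact ih _
  | test m s hs pos next ih => exact ih _
  | query i pos next ih => simp only [bind, queries, eval, add_assoc]; rw [ih]

theorem eval_onPositions (g : Fin n' → Fin n) (c : TapeComputation Q n' α) :
    (c.onPositions g).eval p w a = c.eval (p ∘ g) w a := by
  induction c with
  | ret r => rfl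
  | readBit j next ih => exact ih _
  | test m s hs pos next ih => exact ih _
  | query i pos next ih => exact ih _

theorem time_onPositions (g : Fin n' → Fin n) (c : TapeComputation Q n' α) :
    (c.onPositions g).time cost p w a = c.time cost (p ∘ g) w a := by
  induction c with
  | ret r => rfl
  | readBit j next ih => exact congrArg (1 + ·) (ih _)
  | test m s hs pos next ih => exact congrArg (cost m s + ·) (ih _)
  | query i pos next ih => exact congrArg (1 + ·) (ih _)

theorem queries_onPositions (g : Fin n' → Fin n) (c : TapeComputation Q n' α) :
    (c.onPositions g).queries p w a = c.queries (p ∘ g) w a := by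
  induction c with
  | ret r => rfl
  | readBit j next ih => exact ih _
  | test m s hs pos next ih => exact ih _
  | query i pos next ih => exact congrArg (1 + ·) (ih _)

theorem eval_feed (v : List Bool) (c : TapeComputation Q n α) :
    (c.feed v).eval p w a = c.eval p v a := by
  induction c with
  | ret r => rfl
  | readBit j next ih => exact ih _
  | test m s hs pos next ih => exact ih _
  | query i pos next ih => exact ih _

theorem time_feed_le (v : List Bool) (c : TapeComputation Q n α) :
    (c.feed v).time cost p w a ≤ c.time cost p v a := by
  induction c with
  | ret r => exact le_rfl
  | readBit j next ih => exact (ih _).trans le_add_self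
  | test m s hs pos next ih => simp only [feed, time]; gcongr; exact ih _
  | query i pos next ih => simp only [feed, time]; gcongr; exact ih _

theorem queries_feed (v : List Bool) (c : TapeComputation Q n α) :
    (c.feed v).queries p w a = c.queries p v a := by
  induction c with
  | ret r => rfl
  | readBit j next ih => exact ih _
  | test m s hs pos next ih => exact ih _
  | query i pos next ih => exact congrArg (1 + ·) (ih _)

theorem getD_window (u v w : List Bool) (j : ℕ) :
    (u ++ v ++ w).getD (u.length + j) false =
      if j < v.length then v.getD j false else w.getD (j - v.length) false := by
  split_ifs with h
  · simp [List.getD, List.append_assoc, List.getElem?_append, h]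
  · simp only [List.getD, List.append_assoc, List.getElem?_append]
    simp [h]

/-- Reads past the section are answered by `false`, the value of a blank cell, so a procedure cannot
notice the data stored behind its own. -/
theorem eval_window (u v : List Bool) (c : TapeComputation Q n α) :
    (c.window u.length v.length).eval p (u ++ v ++ w) a = c.eval p v a := by
  induction c with
  | ret r => rfl
  | readBit j next ih =>
    by_cases h : j < v.length
    · simp only [window, h, if_true, eval, getD_window]; exact ih _
    · simp only [window, h, if_false, eval]
      rw [List.getD_eq_default _ _ (not_lt.1 h)]; exact ih _
  | test m s hs pos next ih => exact ih _
  | query i pos next ih => exact ih _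

theorem time_window_le (u v : List Bool) (c : TapeComputation Q n α) :
    (c.window u.length v.length).time cost p (u ++ v ++ w) a ≤ c.time cost p v a := by
  induction c with
  | ret r => exact le_rfl
  | readBit j next ih =>
    by_cases h : j < v.length
    · simp only [window, h, if_true, time, getD_window]; gcongr; exact ih _
    · simp only [window, h, if_false, time]
      rw [List.getD_eq_default _ _ (not_lt.1 h)]; exact (ih _).trans le_add_self
  | test m s hs pos next ih => simp only [window, time]; gcongr; exact ih _
  | query i pos next ih => simp only [window, time]; gcongr; exact ih _

theorem QueryFree.eval_eq {c : TapeComputation Q n α} (hc : c.QueryFree) (a' : Q.Answers) :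
    c.eval p w a = c.eval p w a' := by
  induction c with
  | ret r => rfl
  | readBit j next ih => exact ih _ (hc _)
  | test m s hs pos next ih => exact ih _ (hc _)
  | query i pos next ih => exact hc.elim

theorem QueryFree.time_eq {c : TapeComputation Q n α} (hc : c.QueryFree) (a' : Q.Answers) :
    c.time cost p w a = c.time cost p w a' := by
  induction c with
  | ret r => rfl
  | readBit j next ih => exact congrArg (1 + ·) (ih _ (hc _))
  | test m s hs pos next ih => exact congrArg (cost m s + ·) (ih _ (hc _))
  | query i pos next ih => exact hc.elim

theorem QueryFree.queries_eq {c : TapeComputation Q n α} (hc : c.QueryFree) :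
    c.queries p w a = 0 := by
  induction c with
  | ret r => rfl
  | readBit j next ih => exact ih _ (hc _)
  | test m s hs pos next ih => exact ih _ (hc _)
  | query i pos next ih => exact hc.elim

theorem QueryFree.onPositions {g : Fin n → Fin n'} {c : TapeComputation Q n α}
    (hc : c.QueryFree) : (c.onPositions g).QueryFree := by
  induction c with
  | ret r => trivial
  | readBit j next ih => exact fun b => ih b (hc b)
  | test m s hs pos next ih => exact fun b => ih b (hc b)
  | query i pos next ih => exact hc.elim

theorem QueryFree.feed {v : List Bool} {c : TapeComputation Q n α}
    (hc : c.QueryFree) : (c.feed v).QueryFree := by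
  induction c with
  | ret r => trivial
  | readBit j next ih => exact ih _ (hc _)
  | test m s hs pos next ih => exact fun b => ih b (hc b)
  | query i pos next ih => exact hc.elim

theorem QueryFree.window {o len : ℕ} {c : TapeComputation Q n α}
    (hc : c.QueryFree) : (c.window o len).QueryFree := by
  induction c with
  | ret r => trivial
  | readBit j next ih =>
    rw [TapeComputation.window]
    split_ifs
    · exact fun b => ih b (hc b)
    · exact ih _ (hc _)
  | test m s hs pos next ih => exact fun b => ih b (hc b)
  | query i pos next ih => exact hc.elim

theorem QueryFree.bind {c : TapeComputation Q n α} {f : α → TapeComputation Q n β}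
    (hc : c.QueryFree) (hf : ∀ r, (f r).QueryFree) : (c.bind f).QueryFree := by
  induction c with
  | ret r => exact hf r
  | readBit j next ih => exact fun b => ih b (hc b)
  | test m s hs pos next ih => exact fun b => ih b (hc b)
  | query i pos next ih => exact hc.elim

theorem one_le_time (c : TapeComputation Q n α) : 1 ≤ c.time cost p w a := by
  induction c with
  | ret r => exact le_rfl
  | readBit j next ih => exact le_self_add
  | test m s hs pos next ih => exact (ih _).trans le_add_self
  | query i pos next ih => exact le_self_add

/-- The elements of a list that pass a test carried out by a computation. -/
def select (c : Fin n' → TapeComputation Q n Bool) :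
    List (Fin n') → TapeComputation Q n (List (Fin n'))
  | [] => ret []
  | j :: l => (c j).bind fun b => (select c l).bind fun r => ret (if b then j :: r else r)

theorem eval_select (c : Fin n' → TapeComputation Q n Bool) (l : List (Fin n')) :
    (select c l).eval p w a = l.filter fun j => (c j).eval p w a := by
  induction l with
  | nil => rfl
  | cons j l ih =>
    simp only [select, eval_bind, ih, eval, List.filter_cons]

theorem time_select_le (c : Fin n' → TapeComputation Q n Bool) (l : List (Fin n'))
    {t : ℝ≥0∞} (ht : ∀ j, (c j).time cost p w a ≤ t) :
    (select c l).time cost p w a ≤ l.length * (t + 1) + 1 := by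
  induction l with
  | nil => simp [select, time]
  | cons j l ih =>
    refine (time_bind_le ..).trans ((add_le_add (ht j) ((time_bind_le ..).trans
      (add_le_add ih le_rfl))).trans_eq ?_)
    simp only [time, List.length_cons, Nat.cast_add, Nat.cast_one]
    ring

theorem QueryFree.select {c : Fin n' → TapeComputation Q n Bool} (hc : ∀ j, (c j).QueryFree)
    (l : List (Fin n')) : (select c l).QueryFree := by
  induction l with
  | nil => trivial
  | cons j l ih => exact (hc j).bind fun b => ih.bind fun r => trivial

/-- Each node of the computation splits the space of tape contents into finitely many measurable
pieces, by a test or by the value of a measurable answer. -/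
theorem measurableSet_eval {a : Q.Answers} (ha : ∀ i, Measurable (a i))
    (c : TapeComputation Q n α) (s : Set α) :
    MeasurableSet {p : Fin n → X | c.eval p w a ∈ s} := by
  have hcomp : ∀ {m : ℕ} (pos : Fin m → Fin n), Measurable fun p : Fin n → X => p ∘ pos :=
    fun pos => measurable_pi_lambda _ fun i => measurable_pi_apply _
  induction c with
  | ret r => exact MeasurableSet.const (r ∈ s)
  | readBit j next ih => exact ih _
  | test m t ht pos next ih =>
    have h : {p : Fin n → X | (test m t ht pos next).eval p w a ∈ s} =
        ((fun p => p ∘ pos) ⁻¹' t ∩ {p | (next true).eval p w a ∈ s}) ∪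
        ((fun p => p ∘ pos) ⁻¹' tᶜ ∩ {p | (next false).eval p w a ∈ s}) := by
      ext p
      by_cases hp : p ∘ pos ∈ t <;> simp [eval, hp]
    rw [h]
    exact ((hcomp pos ht).inter (ih _)).union ((hcomp pos ht.compl).inter (ih _))
  | query i pos next ih =>
    have h : {p : Fin n → X | (query i pos next).eval p w a ∈ s} =
        ⋃ r, ((fun p => a i (p ∘ pos)) ⁻¹' {r} ∩ {p | (next r).eval p w a ∈ s}) := by
      ext p
      simp [eval]
    rw [h]
    exact MeasurableSet.iUnion fun r =>
      (((ha i).comp (hcomp pos)) (measurableSet_singleton r)).inter (ih r)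

end TapeComputation

/-! ### Effects of lists of operations -/

namespace LearnerState

variable {X : Type u}

/-- From tapes `p` and `b` and sample counter `σ`, the operations `l` lead to tapes `p'` and `b'`
and sample counter `σ'`, and the tapes never get longer than `c` and `d`. -/
def Performs (ω : ℕ → X) (c d : ℕ) (l : List TapeAction) (p : List X) (b : List Bool) (σ : ℕ)
    (p' : List X) (b' : List Bool) (σ' : ℕ) : Prop :=
  ∀ s : LearnerState X, s.points = p → s.bits = b → s.samples = σ → s.peakPoints ≤ c →
    s.peakBits ≤ d →
    (l.foldl (perform ω) s).points = p' ∧ (l.foldl (perform ω) s).bits = b' ∧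
    (l.foldl (perform ω) s).samples = σ' ∧ (l.foldl (perform ω) s).queries = s.queries ∧
    (l.foldl (perform ω) s).halted = s.halted ∧
    (l.foldl (perform ω) s).time = s.time + l.length ∧
    (l.foldl (perform ω) s).peakPoints ≤ c ∧ (l.foldl (perform ω) s).peakBits ≤ d

variable {ω : ℕ → X} {c d : ℕ} {p p' p'' : List X} {b b' b'' : List Bool} {σ σ' σ'' : ℕ}
  {l l' : List TapeAction}

theorem Performs.nil : Performs ω c d [] p b σ p b σ := by
  intro s h1 h2 h3 h4 h5
  simp [h1, h2, h3, h4, h5]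

theorem Performs.append (h : Performs ω c d l p b σ p' b' σ')
    (h' : Performs ω c d l' p' b' σ' p'' b'' σ'') :
    Performs ω c d (l ++ l') p b σ p'' b'' σ'' := by
  intro s h1 h2 h3 h4 h5
  obtain ⟨e1, e2, e3, e4, e5, e6, e7, e8⟩ := h s h1 h2 h3 h4 h5
  obtain ⟨g1, g2, g3, g4, g5, g6, g7, g8⟩ := h' _ e1 e2 e3 e7 e8
  rw [List.foldl_append]
  refine ⟨g1, g2, g3, g4.trans e4, g5.trans e5, ?_, g7, g8⟩
  rw [g6, e6, List.length_append, Nat.cast_add, add_assoc]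

theorem Performs.sample (hp : p.length + 1 ≤ c) (hb : b.length ≤ d) :
    Performs ω c d [.sample] p b σ (p ++ [ω σ]) b (σ + 1) := by
  rintro s rfl rfl rfl h4 h5
  simp [perform, act, *]

theorem Performs.forget (j : ℕ) (hp : p.length ≤ c) (hb : b.length ≤ d) :
    Performs ω c d [.forget j] p b σ (p.eraseIdx j) b σ := by
  rintro s rfl rfl rfl h4 h5
  have := List.length_eraseIdx_le s.points j
  simp [perform, act, *]
  omega

theorem Performs.swap (i j : ℕ) (hi : i < p.length) (hj : j < p.length) (hp : p.length ≤ c)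
    (hb : b.length ≤ d) :
    Performs ω c d [.swap i j] p b σ ((p.set i p[j]).set j p[i]) b σ := by
  rintro s rfl rfl rfl h4 h5
  simp [perform, act, *]

theorem Performs.write (x : Bool) (hp : p.length ≤ c) (hb : b.length + 1 ≤ d) :
    Performs ω c d [.write x] p b σ p (b ++ [x]) σ := by
  rintro s rfl rfl rfl h4 h5
  simp [perform, act, *]

theorem Performs.erase (hp : p.length ≤ c) (hb : b.length ≤ d) :
    Performs ω c d [.erase] p b σ p b.dropLast σ := by
  rintro s rfl rfl rfl h4 h5
  simp [perform, act, *]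
  omega

theorem Performs.writes (v : List Bool) (hp : p.length ≤ c) (hb : b.length + v.length ≤ d) :
    Performs ω c d (v.map .write) p b σ p (b ++ v) σ := by
  induction v generalizing b with
  | nil => simpa using Performs.nil
  | cons x v ih =>
    simp only [List.length_cons] at hb
    have h := (Performs.write (ω := ω) (σ := σ) x hp (by omega : b.length + 1 ≤ d)).append
      (ih (b := b ++ [x]) (by simp; omega))
    simpa using h

theorem Performs.erases (hp : p.length ≤ c) (hb : b.length ≤ d) :
    Performs ω c d (List.replicate b.length .erase) p b σ p [] σ := by
  generalize hn : b.length = n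
  induction n generalizing b with
  | zero => simpa [List.length_eq_zero_iff.1 hn] using Performs.nil
  | succ n ih =>
    exact (Performs.erase (ω := ω) (σ := σ) hp hb).append
      (ih (b := b.dropLast) (by simp; omega) (by simp [hn]))

theorem Performs.forgets (hp : p.length ≤ c) (hb : b.length ≤ d) (r : List X) :
    p = p' ++ r →
    Performs ω c d (List.replicate p'.length (.forget 0)) p b σ r b σ := by
  rintro rfl
  induction p' with
  | nil => simpa using Performs.nil
  | cons x q ih =>
    have h := (Performs.forget (ω := ω) (σ := σ) 0 hp hb)
    simp only [List.cons_append, List.eraseIdx_zero, List.tail_cons] at h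
    exact h.append (ih (by simp at hp ⊢; omega))

end LearnerState

open LearnerState

/-- Exchanging and removing suffices to leave any selection of points, in any order. -/
theorem exists_arrangement {ι : Type} (idx target : List ι) (ht : target.Nodup)
    (hs : target ⊆ idx) :
    ∃ l : List TapeAction, l.length ≤ 2 * idx.length ∧
      ∀ (X : Type u) (f : ι → X) (ω : ℕ → X) (c d : ℕ) (b : List Bool) (σ : ℕ) (r : List X),
        idx.length + r.length ≤ c → b.length ≤ d →
        Performs ω c d l (idx.map f ++ r) b σ (target.map f ++ r) b σ := by
  classical
  induction target using List.reverseRecOn generalizing idx with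
  | nil =>
    refine ⟨List.replicate idx.length (.forget 0), by simp; omega, ?_⟩
    intro X f ω c d b σ r hc hd
    have := Performs.forgets (ω := ω) (σ := σ) (p' := idx.map f) (p := idx.map f ++ r) (c := c)
      (by simpa using hc) hd r rfl
    simpa using this
  | append_singleton ts t ih =>
    obtain ⟨i, hi, hit⟩ := List.mem_iff_getElem.1 (hs (by simp : t ∈ ts ++ [t]))
    obtain ⟨init, y, rfl⟩ : ∃ init y, idx = init ++ [y] := by
      rcases List.eq_nil_or_concat idx with h | ⟨a, b, h⟩
      · simp [h] at hi
      · exact ⟨a, b, by simpa using h⟩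
    have hnd := List.nodup_append.1 ht
    have hts : t ∉ ts := fun h => hnd.2.2 t h t (by simp) rfl
    have hsub : ts ⊆ init.set i y := by
      intro z hz
      have hzt : z ≠ t := fun h => hts (h ▸ hz)
      rcases List.mem_append.1 (hs (List.mem_append_left _ hz)) with h | h
      · obtain ⟨j, hj, rfl⟩ := List.mem_iff_getElem.1 h
        have hij : i ≠ j := by
          rintro rfl
          rw [List.getElem_append_left hj] at hit
          exact hzt hit
        rw [List.mem_iff_getElem]
        exact ⟨j, by simpa using hj, by rw [List.getElem_set_of_ne hij]⟩
      · have hzy : z = y := by simpa using h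
        subst hzy
        have hil : i < init.length := by
          by_contra hcon
          have : i = init.length := by simp at hi; omega
          subst this
          simp at hit
          exact hzt hit
        exact List.mem_iff_getElem.2 ⟨i, by simpa using hil, by simp⟩
    -- One exchange brings the last target point to the end of the tape. From then on it belongs to
    -- the untouched tail `r`, and the rest is arranged by induction. If it is already last,
    -- `init.set i y` is just `init`.
    obtain ⟨l, hl, hperf⟩ := ih (init.set i y) hnd.1 hsub
    refine ⟨.swap i init.length :: l, by simp at hl ⊢; omega, ?_⟩
    intro X f ω c d b σ r hc hd
    simp only [List.length_append, List.length_singleton] at hc hi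
    have h1 := Performs.swap (ω := ω) (σ := σ) (c := c) (b := b) (d := d)
      (p := (init ++ [y]).map f ++ r) i init.length
      (by simp; omega) (by simp) (by simp; omega) hd
    have h2 := hperf X f ω c d b σ ([f t] ++ r) (by simp; omega) hd
    have key : ((((init ++ [y]).map f ++ r).set i
        (((init ++ [y]).map f ++ r)[init.length]'(by simp))).set init.length
        (((init ++ [y]).map f ++ r)[i]'(by simp; omega))) =
        (init.set i y).map f ++ ([f t] ++ r) := by
      have e1 : (((init ++ [y]).map f ++ r)[i]'(by simp; omega)) = f t := by
        rw [List.getElem_append_left (by simp; omega), List.getElem_map, hit]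
      have e2 : (((init ++ [y]).map f ++ r)[init.length]'(by simp)) = f y := by
        simp
      rw [e1, e2]
      rcases Nat.lt_or_ge i init.length with h | h
      · simp [List.map_set, h]
      · have : i = init.length := by omega
        subst this
        simp only [List.map_append, List.set_append, List.map_set, List.length_append]
        simp [List.set_eq_of_length_le]
    rw [key] at h1
    have := h1.append h2
    simpa using this

/-! ### Coverage of a list of points -/

section Coverage

variable {X : Type u} {Q : QueryClass.{u, v} X}

/-- The set `I_R(q(S))` for the sample that is listed by `l` and the response given by `a`. -/
def covered (R : InferenceRule Q) (a : Q.Answers) (l : List X) : Set X :=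
  R.infer l.length l.get (Q.table a l.get)

/-- The points that are inferred from the points of one label in `l`. -/
def coveredByClass (R : InferenceRule Q) (a : Q.Answers) (h : Q.Hyp) (l : List X) : Set X :=
  ⋃ z : Bool, covered R a (l.filter fun x => Q.label h x = z)

variable {R : InferenceRule Q} {a : Q.Answers} {h : Q.Hyp}

/-- The length of `List.ofFn p` equals `n` only propositionally; rewriting the pair of length and
sample avoids casts. -/
theorem covered_ofFn {n : ℕ} (p : Fin n → X) :
    covered R a (List.ofFn p) = R.infer n p (Q.table a p) :=
  congrArg (fun s : Σ n, Fin n → X => R.infer s.1 s.2 (Q.table a s.2))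
    (List.equivSigmaTuple.apply_symm_apply ⟨n, p⟩)

theorem table_mem_responses (ha : Q.IsValid h a) {n : ℕ} (S : Fin n → X) :
    Q.table a S ∈ Q.responses h S :=
  ⟨a, ha, rfl⟩

/-- The map `ρ` in `InferenceRule.mono` is arbitrary, so inclusion as sets suffices, irrespective of
order and repetitions. -/
theorem covered_mono (ha : Q.IsValid h a) {l l' : List X} (hl : l ⊆ l') :
    covered R a l ⊆ covered R a l' := by
  have hρ : ∀ i : Fin l.length, ∃ j : Fin l'.length, l'.get j = l.get i :=
    fun i => List.mem_iff_get.1 (hl (List.get_mem l i))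
  choose ρ hρ using hρ
  have hc : l'.get ∘ ρ = l.get := funext hρ
  have := R.mono h _ l'.get _ (table_mem_responses ha l'.get) _ ρ
  rw [hc] at this
  unfold covered
  rw [← hc] at this ⊢
  exact this

theorem mem_covered (ha : Q.IsValid h a) {l : List X} {x : X} (hx : x ∈ l) :
    x ∈ covered R a l := by
  obtain ⟨i, rfl⟩ := List.mem_iff_get.1 hx
  exact R.mem_infer h _ l.get _ (table_mem_responses ha _) i

theorem coveredByClass_mono (ha : Q.IsValid h a) {l l' : List X} (hl : l ⊆ l') :
    coveredByClass R a h l ⊆ coveredByClass R a h l' :=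
  Set.iUnion_mono fun z => covered_mono ha fun x hx => by
    simp only [List.mem_filter] at hx ⊢
    exact ⟨hl hx.1, hx.2⟩

theorem mem_coveredByClass (ha : Q.IsValid h a) {l : List X} {x : X} (hx : x ∈ l) :
    x ∈ coveredByClass R a h l :=
  Set.mem_iUnion.2 ⟨Q.label h x, mem_covered ha (by simp [hx])⟩

theorem covered_compress {k : ℕ} (W : LosslessCompression R k) (ha : Q.IsValid h a) {n : ℕ}
    (S : Fin n → X) (hS : Monochromatic Q h S) :
    covered R a ((W.W n S (Q.table a S)).map S) = covered R a (List.ofFn S) := by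
  rw [covered_ofFn, W.lossless h n S hS _ (table_mem_responses ha S)]
  have : (W.W n S (Q.table a S)).map S = List.ofFn (S ∘ (W.W n S (Q.table a S)).get) := by
    rw [← List.map_ofFn, List.ofFn_get]
  rw [this, covered_ofFn]
  rfl

theorem exists_covered_eq {k : ℕ} (W : LosslessCompression R k) (ha : Q.IsValid h a)
    (l : List X) {z : Bool} (hl : ∀ x ∈ l, Q.label h x = z) :
    ∃ w ⊆ l, w.length ≤ k ∧ covered R a w = covered R a l := by
  have hm : Monochromatic Q h l.get := ⟨z, fun j => hl _ (List.get_mem _ _)⟩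
  refine ⟨(W.W l.length l.get (Q.table a l.get)).map l.get, ?_, ?_, ?_⟩
  · intro x hx
    obtain ⟨i, -, rfl⟩ := List.mem_map.1 hx
    exact List.get_mem _ _
  · rw [List.length_map]
    exact W.length_le h _ _ hm _ (table_mem_responses ha _)
  · rw [covered_compress W ha _ hm, List.ofFn_get]

/-- All but `2 k` points of a sample are inferred from the other points. -/
theorem card_not_covered_le {k : ℕ} (W : LosslessCompression R k) (ha : Q.IsValid h a)
    (l : List X) {n : ℕ} (v : Fin (n + 1) → X) (s : Finset (Fin (n + 1)))
    (hs : ∀ j ∈ s, v j ∉ coveredByClass R a h (l ++ List.ofFn (v ∘ j.succAbove))) :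
    s.card ≤ 2 * k := by
  classical
  have hmem : ∀ (j : Fin (n + 1)) x, x ∈ l ++ List.ofFn v → x ≠ v j →
      x ∈ l ++ List.ofFn (v ∘ j.succAbove) := by
    intro j x hx hne
    rcases List.mem_append.1 hx with hx | hx
    · exact List.mem_append_left _ hx
    · obtain ⟨i, rfl⟩ := (List.mem_ofFn' v x).1 hx
      obtain ⟨i', rfl⟩ := Fin.exists_succAbove_eq (fun e => hne (e ▸ rfl) : i ≠ j)
      exact List.mem_append_right _ ((List.mem_ofFn' _ _).2 ⟨i', rfl⟩)
  -- A point that occurs twice is covered by its other occurrence.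
  have hinj : Set.InjOn v s := by
    intro i hi j hj hij
    by_contra hne
    refine hs i hi (mem_coveredByClass ha (List.mem_append_right _ ?_))
    obtain ⟨j', hj'⟩ := Fin.exists_succAbove_eq (Ne.symm hne)
    exact (List.mem_ofFn' _ _).2 ⟨j', by simp [hj', hij]⟩
  have hcard : ∀ z : Bool, (s.filter fun j => Q.label h (v j) = z).card ≤ k := by
    intro z
    obtain ⟨w, hw, hwk, hcov⟩ := exists_covered_eq W ha
      ((l ++ List.ofFn v).filter fun x => Q.label h x = z) (z := z)
      (by intro x hx; simpa using (List.mem_filter.1 hx).2)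
    refine le_trans ?_ (w.toFinset_card_le.trans hwk)
    refine Finset.card_le_card_of_injOn v ?_ (hinj.mono fun j hj => (Finset.mem_filter.1 hj).1)
    intro j hj
    replace hj := Finset.mem_filter.1 (Finset.mem_coe.1 hj)
    -- If `v j` is not among the compressed points `w` of its label, then `w` survives the removal
    -- of `v j`, and it covers everything that the full class covers, including `v j`.
    by_contra hjw
    refine hs j hj.1 (Set.mem_iUnion.2 ⟨z, ?_⟩)
    have hsub : w ⊆ (l ++ List.ofFn (v ∘ j.succAbove)).filter fun x => Q.label h x = z := by
      intro x hx
      have hx' := List.mem_filter.1 (hw hx)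
      refine List.mem_filter.2 ⟨hmem j x hx'.1 ?_, hx'.2⟩
      rintro rfl
      exact hjw (by simpa using hx)
    refine covered_mono ha hsub ?_
    rw [hcov]
    refine mem_covered ha (List.mem_filter.2 ⟨List.mem_append_right _ ?_, by simpa using hj.2⟩)
    exact (List.mem_ofFn' _ _).2 ⟨j, rfl⟩
  have hsplit : s.card = (s.filter fun j => Q.label h (v j) = true).card +
      (s.filter fun j => Q.label h (v j) = false).card := by
    rw [← Finset.card_filter_add_card_filter_not (fun j => Q.label h (v j) = true)]
    simp
  have h0 := hcard true
  have h1 := hcard false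
  omega

end Coverage

/-! ### The computations of the learner -/

/-! ### Filling up a compressed sample to a prescribed size -/

section Keep

variable {ι : Type} [DecidableEq ι]

/-- A selection of up to `k` entries of `l` that contains `w`. -/
def keep (k : ℕ) (w l : List ι) : List ι :=
  (w.dedup ++ l.filter fun i => i ∉ w).take k

variable {k : ℕ} {w l : List ι}

theorem dedup_append_perm (hw : w ⊆ l) (hl : l.Nodup) :
    (w.dedup ++ l.filter fun i => i ∉ w).Perm l := by
  refine (List.perm_ext_iff_of_nodup ?_ hl).2 fun x => ?_
  · refine List.nodup_append.2 ⟨List.nodup_dedup w, hl.filter _, ?_⟩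
    rintro x hx y hy rfl
    simp at hx hy
    exact hy.2 hx
  · by_cases hx : x ∈ w
    · simp [hx, hw hx]
    · simp [hx]

theorem keep_subset (hw : w ⊆ l) (hl : l.Nodup) : keep k w l ⊆ l :=
  fun _ hx => (dedup_append_perm hw hl).subset (List.take_subset _ _ hx)

theorem nodup_keep (hw : w ⊆ l) (hl : l.Nodup) : (keep k w l).Nodup :=
  ((dedup_append_perm hw hl).nodup_iff.2 hl).sublist (List.take_sublist _ _)

/-- A compression may have fewer than `k` points, and repetitions. A predictable length allows the
learner to locate the selected groups on the tape without storing their sizes. -/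
theorem length_keep (hw : w ⊆ l) (hl : l.Nodup) : (keep k w l).length = min k l.length := by
  rw [keep, List.length_take, (dedup_append_perm hw hl).length_eq]

theorem subset_keep (hk : w.length ≤ k) : w ⊆ keep k w l := by
  intro x hx
  have hd : w.dedup.length ≤ k := (List.dedup_sublist w).length_le.trans hk
  rw [keep, List.take_append]
  refine List.mem_append_left _ ?_
  rw [List.take_of_length_le hd]
  exact List.mem_dedup.2 hx

end Keep

/-! ### Labels, compression and inference carried out on the tapes -/

section Programs

variable {X : Type u} [MeasurableSpace X] {Q : QueryClass.{u, v} X}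

open Classical in
/-- The response that is expressed by a list of bits. -/
noncomputable def ResponseEncoding.decode (E : ResponseEncoding Q) (n : ℕ) (w : List Bool) :
    Option (Q.Table n) :=
  if h : ∃ q ∈ {q | ∃ (h : Q.Hyp) (S : Fin n → X), q ∈ Q.responses h S}, E.enc n q = w then
    some h.choose
  else none

/-- The encoding of the response given by `a` on the sample that is listed by `l`. -/
def ResponseEncoding.listBits (E : ResponseEncoding Q) (a : Q.Answers) (l : List X) :
    List Bool :=
  E.enc l.length (Q.table a l.get)

variable {R : InferenceRule Q} {k : ℕ} {W : LosslessCompression R k} {E : ResponseEncoding Q}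
  {h : Q.Hyp} {a a' : Q.Answers} {n N : ℕ}

omit [MeasurableSpace X] in
theorem ResponseEncoding.decode_enc (ha : Q.IsValid h a) (S : Fin n → X) :
    E.decode n (E.enc n (Q.table a S)) = some (Q.table a S) := by
  have hex : ∃ q ∈ {q | ∃ (h : Q.Hyp) (S : Fin n → X), q ∈ Q.responses h S},
      E.enc n q = E.enc n (Q.table a S) := ⟨_, ⟨h, S, table_mem_responses ha S⟩, rfl⟩
  rw [decode, dif_pos hex]
  exact congrArg some
    (E.injOn n hex.choose_spec.1 ⟨h, S, table_mem_responses ha S⟩ hex.choose_spec.2)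

omit [MeasurableSpace X] in
theorem ResponseEncoding.listBits_ofFn (S : Fin n → X) :
    E.listBits a (List.ofFn S) = E.enc n (Q.table a S) :=
  congrArg (fun s : Σ n, Fin n → X => E.enc s.1 (Q.table a s.2))
    (List.equivSigmaTuple.apply_symm_apply ⟨n, S⟩)

omit [MeasurableSpace X] in
theorem ResponseEncoding.length_listBits (l : List X) :
    (E.listBits a l).length = E.bits l.length :=
  E.length_enc _ _

omit [MeasurableSpace X] in
theorem ResponseEncoding.bits_le_maxBits (E : ResponseEncoding Q) {m n : ℕ} (hmn : m ≤ n) :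
    E.bits m ≤ E.maxBits n :=
  Finset.le_sup (f := E.bits) (Finset.mem_range.2 (Nat.lt_succ_of_le hmn))

variable (cost : CostModel X)

theorem InferenceProcedure.time_le (J : InferenceProcedure R E) {m : ℕ} (hm : m ≤ n)
    (ha : Q.IsValid h a') (S : Fin m → X) (x : X) :
    (J.prog m).time cost (Fin.snoc S x) (E.enc m (Q.table a' S)) a ≤ J.worstTime cost n := by
  rw [(J.queryFree m).time_eq cost _ _ a a']
  exact le_iSup_of_le m <| le_iSup_of_le hm <| le_iSup_of_le h <| le_iSup_of_le a' <|
    le_iSup_of_le ha <| le_iSup_of_le S <| le_iSup_of_le x le_rfl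

open Classical in
theorem InferenceProcedure.eval_eq (J : InferenceProcedure R E) {m : ℕ}
    (ha : Q.IsValid h a') (S : Fin m → X) (x : X) :
    (J.prog m).eval (Fin.snoc S x) (E.enc m (Q.table a' S)) a =
      if x ∈ R.infer m S (Q.table a' S) then some (Q.label h x) else none := by
  rw [(J.queryFree m).eval_eq _ _ a a']
  exact J.correct m h a' S x ha

theorem CompressionProcedure.time_le (K : CompressionProcedure W E) {m : ℕ} (hm : m ≤ n)
    (ha : Q.IsValid h a') (S : Fin m → X) (hS : Monochromatic Q h S) :
    (K.prog m).time cost S (E.enc m (Q.table a' S)) a ≤ K.worstTime cost n := by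
  rw [(K.queryFree m).time_eq cost _ _ a a']
  exact le_iSup_of_le m <| le_iSup_of_le hm <| le_iSup_of_le h <| le_iSup_of_le a' <|
    le_iSup_of_le ha <| le_iSup_of_le S <| le_iSup_of_le hS le_rfl

theorem QueryProcedure.time_add_bits_le (P : QueryProcedure E) {m : ℕ} (hm : m ≤ n)
    (ha : Q.IsValid h a) (S : Fin m → X) :
    (P.prog m).time cost S [] a + E.bits m ≤ P.worstTime cost n :=
  le_iSup_of_le m <| le_iSup_of_le hm <| le_iSup_of_le h <| le_iSup_of_le a <|
    le_iSup_of_le ha <| le_iSup_of_le S le_rfl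

theorem QueryProcedure.queries_le (P : QueryProcedure E) {m : ℕ} (hm : m ≤ n)
    (ha : Q.IsValid h a) (S : Fin m → X) :
    ((P.prog m).queries S [] a : ℝ≥0∞) ≤ P.numQueries n :=
  le_iSup_of_le m <| le_iSup_of_le hm <| le_iSup_of_le h <| le_iSup_of_le a <|
    le_iSup_of_le ha <| le_iSup_of_le S le_rfl

/-- The time of the query procedure includes the bits that it writes, so it also pays for erasing
and rewriting the work tape. The point `x` only ensures that samples of every size exist. -/
theorem QueryProcedure.maxBits_le (P : QueryProcedure E) (ha : Q.IsValid h a) (x : X) :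
    (E.maxBits n : ℝ≥0∞) ≤ P.worstTime cost n := by
  obtain ⟨m, hm, hmax⟩ := Finset.exists_mem_eq_sup (Finset.range (n + 1))
    ⟨0, by simp⟩ E.bits
  rw [ResponseEncoding.maxBits, hmax]
  exact le_add_self.trans
    (P.time_add_bits_le cost (Nat.lt_succ_iff.1 (Finset.mem_range.1 hm)) ha fun _ => x)

/-- Determines the label of a point of the sample from the response `q` on the sample. -/
def labelProgram (J : InferenceProcedure R E) (g : Fin n → Fin N) (q : Q.Table N) (j : Fin n) :
    TapeComputation Q n Bool :=
  (((J.prog 1).feed (E.enc 1 (Q.restrict (fun _ => g j) q))).onPositions fun _ => j).bind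
    fun r => .ret (r == some true)

/-- Selects up to `k` points, with the same coverage, among the points at the positions `l`,
which have the same label. -/
def compressProgram (K : CompressionProcedure W E) (g : Fin n → Fin N) (q : Q.Table N)
    (l : List (Fin n)) : TapeComputation Q n (List (Fin n)) :=
  (((K.prog l.length).feed (E.enc l.length (Q.restrict (g ∘ l.get) q))).onPositions l.get).bind
    fun w => .ret (keep k (w.map l.get) l)

theorem labelProgram_queryFree (J : InferenceProcedure R E) (g : Fin n → Fin N)
    (q : Q.Table N) (j : Fin n) : (labelProgram J g q j).QueryFree :=
  (J.queryFree 1).feed.onPositions.bind fun _ => trivial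

theorem compressProgram_queryFree (K : CompressionProcedure W E) (g : Fin n → Fin N)
    (q : Q.Table N) (l : List (Fin n)) : (compressProgram K g q l).QueryFree :=
  (K.queryFree _).feed.onPositions.bind fun _ => trivial

variable (p : Fin n → X) (w : List Bool) {g : Fin n → Fin N} {S : Fin N → X}

omit [MeasurableSpace X] in
theorem snoc_const {n : ℕ} (p : Fin n → X) (j : Fin n) :
    (p ∘ fun _ : Fin (1 + 1) => j) = Fin.snoc (fun _ : Fin 1 => p j) (p j) := by
  funext i
  refine Fin.lastCases ?_ (fun i => ?_) i
  · exact (Fin.snoc_last (α := fun _ => X) _ _).symm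
  · exact (Fin.snoc_castSucc (α := fun _ => X) (p j) (fun _ : Fin 1 => p j) i).symm

omit [MeasurableSpace X] in
theorem restrict_table {m : ℕ} (hg : S ∘ g = p) (ρ : Fin m → Fin n) :
    Q.restrict (g ∘ ρ) (Q.table a S) = Q.table a (p ∘ ρ) := by
  subst hg; rfl

/-- There need not be a label oracle. A point is always inferred from the sample that consists of
itself, so the inference procedure on this one-point sample reveals its label. -/
theorem eval_labelProgram (J : InferenceProcedure R E) (ha : Q.IsValid h a')
    (hg : S ∘ g = p) (j : Fin n) :
    (labelProgram J g (Q.table a' S) j).eval p w a = Q.label h (p j) := by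
  have h1 : Q.restrict (fun _ : Fin 1 => g j) (Q.table a' S) = Q.table a' fun _ => p j :=
    restrict_table p hg fun _ => j
  have h2 : p j ∈ R.infer 1 (fun _ => p j) (Q.table a' fun _ => p j) :=
    R.mem_infer h 1 _ _ (table_mem_responses ha _) 0
  rw [labelProgram, TapeComputation.eval_bind, TapeComputation.eval_onPositions,
    TapeComputation.eval_feed, h1, snoc_const, J.eval_eq ha, if_pos h2]
  cases Q.label h (p j) <;> rfl

theorem time_labelProgram_le (J : InferenceProcedure R E) (hk : 1 ≤ k) (ha : Q.IsValid h a')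
    (hg : S ∘ g = p) (j : Fin n) :
    (labelProgram J g (Q.table a' S) j).time cost p w a ≤ J.worstTime cost k + 1 := by
  have h1 : Q.restrict (fun _ : Fin 1 => g j) (Q.table a' S) = Q.table a' fun _ => p j :=
    restrict_table p hg fun _ => j
  refine (TapeComputation.time_bind_le ..).trans (add_le_add ?_ le_rfl)
  rw [TapeComputation.time_onPositions, h1, snoc_const]
  exact (TapeComputation.time_feed_le ..).trans (J.time_le cost hk ha _ _)

theorem eval_compressProgram (K : CompressionProcedure W E) (ha : Q.IsValid h a')
    (hg : S ∘ g = p) {l : List (Fin n)} (hl : l.Nodup) {z : Bool}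
    (hz : ∀ j ∈ l, Q.label h (p j) = z) :
    ∃ A, (compressProgram K g (Q.table a' S) l).eval p w a = A ∧ A ⊆ l ∧ A.Nodup ∧
      A.length = min k l.length ∧ covered R a' (A.map p) = covered R a' (l.map p) := by
  have hm : Monochromatic Q h (p ∘ l.get) := ⟨z, fun j => hz _ (List.get_mem _ _)⟩
  set w' := W.W l.length (p ∘ l.get) (Q.table a' (p ∘ l.get)) with hw'
  have he : (compressProgram K g (Q.table a' S) l).eval p w a = keep k (w'.map l.get) l := by
    rw [compressProgram, TapeComputation.eval_bind, TapeComputation.eval_onPositions,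
      TapeComputation.eval_feed, restrict_table p hg, (K.queryFree _).eval_eq _ _ a a',
      K.correct _ h a' _ ha hm]
    rfl
  have hwl : w'.map l.get ⊆ l := by
    intro x hx
    obtain ⟨i, -, rfl⟩ := List.mem_map.1 hx
    exact List.get_mem _ _
  have hwk : (w'.map l.get).length ≤ k := by
    rw [List.length_map]
    exact W.length_le h _ _ hm _ (table_mem_responses ha _)
  refine ⟨_, he, keep_subset hwl hl, nodup_keep hwl hl, length_keep hwl hl, ?_⟩
  refine (covered_mono ha (List.map_subset p (keep_subset hwl hl))).antisymm ?_
  have h1 : covered R a' (l.map p) = covered R a' ((w'.map l.get).map p) := by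
    rw [List.map_map, covered_compress W ha _ hm, ← List.map_ofFn, List.ofFn_get]
  rw [h1]
  exact covered_mono ha (List.map_subset p (subset_keep hwk))

theorem time_compressProgram_le (K : CompressionProcedure W E) (ha : Q.IsValid h a')
    (hg : S ∘ g = p) {l : List (Fin n)} {z : Bool} (hz : ∀ j ∈ l, Q.label h (p j) = z)
    {m : ℕ} (hlm : l.length ≤ m) :
    (compressProgram K g (Q.table a' S) l).time cost p w a ≤ K.worstTime cost m + 1 := by
  have hm : Monochromatic Q h (p ∘ l.get) := ⟨z, fun j => hz _ (List.get_mem _ _)⟩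
  refine (TapeComputation.time_bind_le ..).trans (add_le_add ?_ le_rfl)
  rw [TapeComputation.time_onPositions, restrict_table p hg]
  exact (TapeComputation.time_feed_le ..).trans (K.time_le cost hlm ha _ hm)

/-- Looks up whether the last point on the query tape is inferred, and with which label, from the
first `k` points or from the next `m` points; the work tape holds the responses on these. -/
def lookupProgram (J : InferenceProcedure R E) (k m : ℕ) (hn : k + m < n) :
    TapeComputation Q n (Option Bool) :=
  (((J.prog k).window 0 (E.bits k)).onPositions
    (Fin.snoc (α := fun _ => Fin n) (fun i : Fin k => ⟨i, by omega⟩) ⟨n - 1, by omega⟩)).bind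
  fun r => (((J.prog m).window (E.bits k) (E.bits m)).onPositions
    (Fin.snoc (α := fun _ => Fin n) (fun i : Fin m => ⟨k + i, by omega⟩)
      ⟨n - 1, by omega⟩)).bind
  fun r' => .ret (r.or r')

theorem lookupProgram_queryFree (J : InferenceProcedure R E) (k m : ℕ) (hn : k + m < n) :
    (lookupProgram J k m hn).QueryFree :=
  (J.queryFree _).window.onPositions.bind fun _ =>
    (J.queryFree _).window.onPositions.bind fun _ => trivial

section Lookup

variable {A B C : List X} {x : X}

omit [MeasurableSpace X] in
theorem ofFn_left_eq (hp : List.ofFn p = A ++ B ++ C ++ [x]) (hA : A.length ≤ n) :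
    List.ofFn (fun i : Fin A.length => p ⟨i, by omega⟩) = A := by
  refine List.ext_getElem (by simp) fun i h1 h2 => ?_
  have : (List.ofFn p)[i]'(by simp; omega) = (A ++ B ++ C ++ [x])[i]'(by simp; omega) := by
    simp only [hp]
  simpa [List.getElem_append, h2, List.append_assoc] using this

omit [MeasurableSpace X] in
theorem ofFn_right_eq (hp : List.ofFn p = A ++ B ++ C ++ [x])
    (hA : A.length + B.length ≤ n) :
    List.ofFn (fun i : Fin B.length => p ⟨A.length + i, by omega⟩) = B := by
  refine List.ext_getElem (by simp) fun i h1 h2 => ?_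
  have : (List.ofFn p)[A.length + i]'(by simp; omega) =
      (A ++ B ++ C ++ [x])[A.length + i]'(by simp; omega) := by
    simp only [hp]
  simpa [List.getElem_append, h2, List.append_assoc] using this

omit [MeasurableSpace X] in
theorem last_eq_of_ofFn (hp : List.ofFn p = A ++ B ++ C ++ [x]) (hn : n - 1 < n) :
    p ⟨n - 1, hn⟩ = x := by
  have hlen := congrArg List.length hp
  simp only [List.length_ofFn, List.length_append, List.length_singleton] at hlen
  have : (List.ofFn p)[n - 1]'(by simpa using hn) =
      (A ++ B ++ C ++ [x])[n - 1]'(by simp; omega) := by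
    simp only [hp]
  simp only [List.getElem_ofFn] at this
  rw [this, List.getElem_append_right (by simp; omega)]
  simp

-- The tape layout is `A`, `B`, further points `C`, and the tested point `x`. The two lookups cannot
-- conflict: whatever is inferred is the true label, so `Option.or` decides membership in the union.
open Classical in
theorem eval_lookupProgram (J : InferenceProcedure R E) (ha : Q.IsValid h a')
    (hp : List.ofFn p = A ++ B ++ C ++ [x]) (hn : A.length + B.length < n) {F : Set X}
    (hF : covered R a' A ∪ covered R a' B = F) :
    (lookupProgram J A.length B.length hn).eval p (E.listBits a' A ++ E.listBits a' B) a =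
      if x ∈ F then some (Q.label h x) else none := by
  subst hF
  have hAl := ofFn_left_eq p hp (by omega)
  have hBl := ofFn_right_eq p hp (by omega)
  have hx := last_eq_of_ofFn p hp (by omega)
  have hcA := covered_ofFn (R := R) (a := a') (fun i : Fin A.length => p ⟨i, by omega⟩)
  have hcB := covered_ofFn (R := R) (a := a') (fun i : Fin B.length => p ⟨A.length + i, by omega⟩)
  have hbA := E.listBits_ofFn (a := a') (fun i : Fin A.length => p ⟨i, by omega⟩)
  have hbB := E.listBits_ofFn (a := a') (fun i : Fin B.length => p ⟨A.length + i, by omega⟩)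
  rw [hAl] at hcA hbA
  rw [hBl] at hcB hbB
  have e1 := (J.prog A.length).eval_window
    (Fin.snoc (α := fun _ => X) (fun i : Fin A.length => p ⟨i, by omega⟩) x)
    (E.listBits a' B) a [] (E.listBits a' A)
  have e2 := (J.prog B.length).eval_window
    (Fin.snoc (α := fun _ => X) (fun i : Fin B.length => p ⟨A.length + i, by omega⟩) x)
    [] a (E.listBits a' A) (E.listBits a' B)
  rw [E.length_listBits, hbA, J.eval_eq ha, ← hcA] at e1
  rw [E.length_listBits, E.length_listBits, hbB, J.eval_eq ha, ← hcB] at e2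
  rw [← hbA] at e1
  rw [← hbB] at e2
  simp only [List.length_nil, List.nil_append, List.append_nil] at e1 e2
  rw [lookupProgram, TapeComputation.eval_bind, TapeComputation.eval_onPositions,
    Fin.comp_snoc, hx, TapeComputation.eval_bind, TapeComputation.eval_onPositions,
    Fin.comp_snoc, hx]
  simp only [TapeComputation.eval]
  erw [e1, e2]
  by_cases h1 : x ∈ covered R a' A <;> by_cases h2 : x ∈ covered R a' B <;> simp [h1, h2]

theorem time_lookupProgram_le (J : InferenceProcedure R E) (ha : Q.IsValid h a')
    (hp : List.ofFn p = A ++ B ++ C ++ [x]) (hn : A.length + B.length < n)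
    (hA : A.length ≤ k) (hB : B.length ≤ k) :
    (lookupProgram J A.length B.length hn).time cost p (E.listBits a' A ++ E.listBits a' B) a ≤
      J.worstTime cost k + (J.worstTime cost k + 1) := by
  have hAl := ofFn_left_eq p hp (by omega)
  have hBl := ofFn_right_eq p hp (by omega)
  have hbA := E.listBits_ofFn (a := a') (fun i : Fin A.length => p ⟨i, by omega⟩)
  have hbB := E.listBits_ofFn (a := a') (fun i : Fin B.length => p ⟨A.length + i, by omega⟩)
  rw [hAl] at hbA
  rw [hBl] at hbB
  have e1 := (J.prog A.length).time_window_le cost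
    (Fin.snoc (α := fun _ => X) (fun i : Fin A.length => p ⟨i, by omega⟩)
      (p ⟨n - 1, by omega⟩))
    (E.listBits a' B) a [] (E.listBits a' A)
  have e2 := (J.prog B.length).time_window_le cost
    (Fin.snoc (α := fun _ => X) (fun i : Fin B.length => p ⟨A.length + i, by omega⟩)
      (p ⟨n - 1, by omega⟩))
    [] a (E.listBits a' A) (E.listBits a' B)
  have t1 := J.time_le cost hA ha (a := a) (fun i : Fin A.length => p ⟨i, by omega⟩)
    (p ⟨n - 1, by omega⟩)
  have t2 := J.time_le cost hB ha (a := a) (fun i : Fin B.length => p ⟨A.length + i, by omega⟩)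
    (p ⟨n - 1, by omega⟩)
  rw [← hbA] at t1
  rw [← hbB] at t2
  replace e1 := e1.trans t1
  replace e2 := e2.trans t2
  rw [E.length_listBits] at e1
  rw [E.length_listBits, E.length_listBits] at e2
  simp only [List.length_nil, List.nil_append, List.append_nil] at e1 e2
  refine (TapeComputation.time_bind_le ..).trans (add_le_add ?_ ?_)
  · rw [TapeComputation.time_onPositions, Fin.comp_snoc]
    exact e1
  · refine (TapeComputation.time_bind_le ..).trans (add_le_add ?_ le_rfl)
    rw [TapeComputation.time_onPositions, Fin.comp_snoc]
    exact e2

end Lookup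

end Programs

/-! ### Selecting points after the queries of a round -/

section Update

variable {X : Type u} [MeasurableSpace X] {Q : QueryClass.{u, v} X}
  {R : InferenceRule Q} {k : ℕ} {W : LosslessCompression R k} {E : ResponseEncoding Q}
  {h : Q.Hyp} {a a' : Q.Answers} {n N : ℕ}

/-- Lists the points on a tape of positive length, and repeats the first point. -/
def padding (N : ℕ) (hn : 0 < n) (i : Fin N) : Fin n :=
  if hi : (i : ℕ) < n then ⟨i, hi⟩ else ⟨0, hn⟩

theorem padding_castLE (hn : 0 < n) (hN : n ≤ N) (j : Fin n) :
    padding N hn (Fin.castLE hN j) = j := by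
  simp [padding]

/-- Given the response on the sample, selects at most `k` points of each label with the same
coverage, and the encodings of the responses on these points. More points are selected from the
label that occurs more often. -/
def selectProgram (K : CompressionProcedure W E) (J : InferenceProcedure R E)
    (hN : n ≤ N) (q : Q.Table N) :
    TapeComputation Q n (Option (List (Fin n) × List (Fin n) × List Bool)) :=
  (TapeComputation.select (labelProgram J (Fin.castLE hN) q) (List.finRange n)).bind fun l =>
  (compressProgram K (Fin.castLE hN) q l).bind fun A =>
  (compressProgram K (Fin.castLE hN) q ((List.finRange n).filter (· ∉ l))).bind fun B =>
  .ret <| some <|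
    let r := if B.length ≤ A.length then (A, B) else (B, A)
    (r.1, r.2, E.enc r.1.length (Q.restrict (Fin.castLE hN ∘ r.1.get) q) ++
      E.enc r.2.length (Q.restrict (Fin.castLE hN ∘ r.2.get) q))

/-- Infers the response on the sample on the query tape, and selects points by
`selectProgram`. -/
noncomputable def updateProgram (P : QueryProcedure E) (K : CompressionProcedure W E)
    (J : InferenceProcedure R E) (N n : ℕ) :
    TapeComputation Q n (Option (List (Fin n) × List (Fin n) × List Bool)) :=
  if hn : 0 < n ∧ n ≤ N then
    (((P.prog N).feed []).onPositions (padding N hn.1)).bind fun bits =>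
      match E.decode N bits with
      | none => .ret none
      | some q => selectProgram K J hn.2 q
  else .ret none

variable (P : QueryProcedure E) (K : CompressionProcedure W E) (J : InferenceProcedure R E)
  (cost : CostModel X) (p : Fin n → X) (w : List Bool) {S : Fin N → X}

theorem selectProgram_queryFree (hN : n ≤ N) (q : Q.Table N) :
    (selectProgram K J hN q).QueryFree :=
  (TapeComputation.QueryFree.select (labelProgram_queryFree J _ q) _).bind fun _ =>
    (compressProgram_queryFree K _ q _).bind fun _ =>
      (compressProgram_queryFree K _ q _).bind fun _ => trivial

/-- Of at least `2 k` points, at least `k` share a label. Listing the larger selection first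
therefore makes the first group have exactly `k` points. -/
theorem eval_selectProgram (ha : Q.IsValid h a') (hN : n ≤ N) (hp : S ∘ Fin.castLE hN = p)
    (hkn : 2 * k ≤ n) :
    ∃ A B, (selectProgram K J hN (Q.table a' S)).eval p w a =
        some (A, B, E.listBits a' (A.map p) ++ E.listBits a' (B.map p)) ∧
      A.length = k ∧ B.length ≤ k ∧ (A ++ B).Nodup ∧
      covered R a' (A.map p) ∪ covered R a' (B.map p) = coveredByClass R a' h (List.ofFn p) ∧
      coveredByClass R a' h ((A ++ B).map p) = coveredByClass R a' h (List.ofFn p) := by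
  set g := Fin.castLE hN with hg
  have hlab := fun j => eval_labelProgram (a := a) (E := E) p w J ha hp j
  set l := (List.finRange n).filter (fun j => Q.label h (p j) = true) with hl
  set l' := (List.finRange n).filter (fun j => Q.label h (p j) = false) with hl'
  have e1 : (TapeComputation.select (labelProgram J g (Q.table a' S)) (List.finRange n)).eval
      p w a = l := by
    rw [TapeComputation.eval_select, hl]
    exact List.filter_congr fun j _ => by rw [hlab]; simp
  have e2 : (List.finRange n).filter (· ∉ l) = l' :=
    List.filter_congr fun j _ => by simp [hl]
  have hnl : l.Nodup := (List.nodup_finRange n).filter _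
  have hnl' : l'.Nodup := (List.nodup_finRange n).filter _
  have hz : ∀ j ∈ l, Q.label h (p j) = true := fun j hj => by
    simpa using (List.mem_filter.1 hj).2
  have hz' : ∀ j ∈ l', Q.label h (p j) = false := fun j hj => by
    simpa using (List.mem_filter.1 hj).2
  obtain ⟨A, hA, hAl, hAn, hAlen, hAc⟩ :=
    eval_compressProgram (a := a) (R := R) p w K ha hp hnl hz
  obtain ⟨B, hB, hBl, hBn, hBlen, hBc⟩ :=
    eval_compressProgram (a := a) (R := R) p w K ha hp hnl' hz'
  have hlen : l.length + l'.length = n := by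
    have := List.length_eq_length_filter_add (l := List.finRange n)
      (fun j => decide (Q.label h (p j) = true))
    rw [List.length_finRange] at this
    refine Eq.trans ?_ this.symm
    rw [hl, hl']
    congr 2
    exact List.filter_congr fun j _ => by cases Q.label h (p j) <;> simp
  have hdis : ∀ x ∈ A, ∀ y ∈ B, x ≠ y := by
    rintro x hx y hy rfl
    have := hz x (hAl hx)
    rw [hz' x (hBl hy)] at this
    cases this
  have hfil : ∀ z : Bool, (List.ofFn p).filter (fun x => Q.label h x = z) =
      ((List.finRange n).filter fun j => Q.label h (p j) = z).map p := by
    intro z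
    rw [List.ofFn_eq_map, List.filter_map]
    rfl
  have hcov : covered R a' (A.map p) ∪ covered R a' (B.map p) =
      coveredByClass R a' h (List.ofFn p) := by
    rw [hAc, hBc, coveredByClass, hl, hl', ← hfil, ← hfil]
    ext x
    simp [or_comm]
  have hAt : (A.map p).filter (fun x => Q.label h x = true) = A.map p :=
    List.filter_eq_self.2 fun x hx => by
      obtain ⟨j, hj, rfl⟩ := List.mem_map.1 hx
      simp [hz j (hAl hj)]
  have hAf : (A.map p).filter (fun x => Q.label h x = false) = [] :=
    List.filter_eq_nil_iff.2 fun x hx => by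
      obtain ⟨j, hj, rfl⟩ := List.mem_map.1 hx
      simp [hz j (hAl hj)]
  have hBt : (B.map p).filter (fun x => Q.label h x = true) = [] :=
    List.filter_eq_nil_iff.2 fun x hx => by
      obtain ⟨j, hj, rfl⟩ := List.mem_map.1 hx
      simp [hz' j (hBl hj)]
  have hBf : (B.map p).filter (fun x => Q.label h x = false) = B.map p :=
    List.filter_eq_self.2 fun x hx => by
      obtain ⟨j, hj, rfl⟩ := List.mem_map.1 hx
      simp [hz' j (hBl hj)]
  have hcls : coveredByClass R a' h (A.map p ++ B.map p) =
      covered R a' (A.map p) ∪ covered R a' (B.map p) := by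
    ext x
    simp only [coveredByClass, Set.mem_iUnion, Bool.exists_bool, List.filter_append, hAt, hAf,
      hBt, hBf, List.nil_append, List.append_nil, Set.mem_union]
    exact or_comm
  have hcls' : coveredByClass R a' h (B.map p ++ A.map p) =
      covered R a' (A.map p) ∪ covered R a' (B.map p) := by
    ext x
    simp only [coveredByClass, Set.mem_iUnion, Bool.exists_bool, List.filter_append, hAt, hAf,
      hBt, hBf, List.nil_append, List.append_nil, Set.mem_union]
    exact or_comm
  have hbits : ∀ C : List (Fin n), E.enc C.length (Q.restrict (g ∘ C.get) (Q.table a' S)) =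
      E.listBits a' (C.map p) := by
    intro C
    rw [restrict_table p hp, ← E.listBits_ofFn, ← List.map_ofFn, List.ofFn_get]
  have he : (selectProgram K J hN (Q.table a' S)).eval p w a =
      some (let r := if B.length ≤ A.length then (A, B) else (B, A)
        (r.1, r.2, E.listBits a' (r.1.map p) ++ E.listBits a' (r.2.map p))) := by
    rw [selectProgram, TapeComputation.eval_bind, e1, TapeComputation.eval_bind, hA,
      TapeComputation.eval_bind, e2, hB]
    simp only [TapeComputation.eval, hbits, ← hg]
  rw [he]
  split_ifs with hAB
  · refine ⟨A, B, rfl, by omega, by omega, List.nodup_append.2 ⟨hAn, hBn, hdis⟩, hcov, ?_⟩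
    rw [List.map_append, hcls, hcov]
  · refine ⟨B, A, rfl, by omega, by omega, List.nodup_append.2 ⟨hBn, hAn, ?_⟩, ?_, ?_⟩
    · exact fun x hx y hy e => hdis y hy x hx e.symm
    · rw [Set.union_comm, hcov]
    · rw [List.map_append, hcls', hcov]

theorem time_selectProgram_le (hk : 1 ≤ k) (ha : Q.IsValid h a') (hN : n ≤ N)
    (hp : S ∘ Fin.castLE hN = p) {m : ℕ} (hm : n ≤ m) :
    (selectProgram K J hN (Q.table a' S)).time cost p w a ≤
      n * (J.worstTime cost k + 2) + 2 * K.worstTime cost m + 4 := by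
  set g := Fin.castLE hN with hg
  have hlab := fun j => eval_labelProgram (a := a) (E := E) p w J ha hp j
  set l := (List.finRange n).filter (fun j => Q.label h (p j) = true) with hl
  set l' := (List.finRange n).filter (fun j => Q.label h (p j) = false) with hl'
  have e1 : (TapeComputation.select (labelProgram J g (Q.table a' S)) (List.finRange n)).eval
      p w a = l := by
    rw [TapeComputation.eval_select, hl]
    exact List.filter_congr fun j _ => by rw [hlab]; simp
  have e2 : (List.finRange n).filter (· ∉ l) = l' :=
    List.filter_congr fun j _ => by simp [hl]
  have hz : ∀ j ∈ l, Q.label h (p j) = true := fun j hj => by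
    simpa using (List.mem_filter.1 hj).2
  have hz' : ∀ j ∈ l', Q.label h (p j) = false := fun j hj => by
    simpa using (List.mem_filter.1 hj).2
  have hll : l.length ≤ m :=
    ((List.length_filter_le _ _).trans (List.length_finRange).le).trans hm
  have hll' : l'.length ≤ m :=
    ((List.length_filter_le _ _).trans (List.length_finRange).le).trans hm
  have t1 := TapeComputation.time_select_le cost p w a (labelProgram J g (Q.table a' S))
    (List.finRange n) (time_labelProgram_le cost p w J hk ha hp)
  rw [List.length_finRange] at t1
  have t2 := time_compressProgram_le (a := a) cost p w K ha hp hz hll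
  have t3 := time_compressProgram_le (a := a) cost p w K ha hp hz' hll'
  refine (TapeComputation.time_bind_le ..).trans ?_
  rw [e1]
  refine (add_le_add t1 ((TapeComputation.time_bind_le ..).trans
    (add_le_add t2 ((TapeComputation.time_bind_le ..).trans
      (add_le_add (b := K.worstTime cost m + 1) ?_ le_rfl))))).trans_eq ?_
  · rw [e2]; exact t3
  · simp only [TapeComputation.time]
    ring

variable (hP : ∀ S : Fin N → X, (P.prog N).eval S [] a = E.enc N (Q.table a' S))

include hP

/-- The query procedure guarantees a common choice `a'` of answers only for samples of one size.
Padding every sample to `N` entries makes all updates refer to the same `a'`; the response on the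
actual sample is a restriction. -/
theorem eval_updateProgram (ha : Q.IsValid h a') (hn : 0 < n) (hN : n ≤ N) (hkn : 2 * k ≤ n) :
    ∃ A B, (updateProgram P K J N n).eval p w a =
        some (A, B, E.listBits a' (A.map p) ++ E.listBits a' (B.map p)) ∧
      A.length = k ∧ B.length ≤ k ∧ (A ++ B).Nodup ∧
      covered R a' (A.map p) ∪ covered R a' (B.map p) = coveredByClass R a' h (List.ofFn p) ∧
      coveredByClass R a' h ((A ++ B).map p) = coveredByClass R a' h (List.ofFn p) := by
  have hp : (p ∘ padding N hn) ∘ Fin.castLE hN = p :=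
    funext fun j => congrArg p (padding_castLE hn hN j)
  obtain ⟨A, B, h1, h2⟩ := eval_selectProgram (a := a) K J p w ha hN hp hkn
  refine ⟨A, B, ?_, h2⟩
  rw [updateProgram, dif_pos ⟨hn, hN⟩, TapeComputation.eval_bind,
    TapeComputation.eval_onPositions, TapeComputation.eval_feed, hP, E.decode_enc ha]
  exact h1

theorem time_updateProgram_le (hk : 1 ≤ k) (ha : Q.IsValid h a) (ha' : Q.IsValid h a')
    (hn : 0 < n) (hN : n ≤ N) {m : ℕ} (hm : N ≤ m) :
    (updateProgram P K J N n).time cost p w a ≤ P.worstTime cost m +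
      (n * (J.worstTime cost k + 2) + 2 * K.worstTime cost m + 4) := by
  have hp : (p ∘ padding N hn) ∘ Fin.castLE hN = p :=
    funext fun j => congrArg p (padding_castLE hn hN j)
  rw [updateProgram, dif_pos ⟨hn, hN⟩]
  refine (TapeComputation.time_bind_le ..).trans (add_le_add ?_ ?_)
  · rw [TapeComputation.time_onPositions]
    exact (TapeComputation.time_feed_le ..).trans
      (le_self_add.trans (P.time_add_bits_le cost hm ha _))
  · rw [TapeComputation.eval_onPositions, TapeComputation.eval_feed, hP, E.decode_enc ha']
    exact time_selectProgram_le K J cost p w hk ha' hN hp (hN.trans hm)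

theorem queries_updateProgram_le (ha : Q.IsValid h a) (ha' : Q.IsValid h a')
    (hn : 0 < n) (hN : n ≤ N) :
    ((updateProgram P K J N n).queries p w a : ℝ≥0∞) ≤ P.numQueries N := by
  rw [updateProgram, dif_pos ⟨hn, hN⟩, TapeComputation.queries_bind,
    TapeComputation.queries_onPositions, TapeComputation.queries_feed,
    TapeComputation.eval_onPositions, TapeComputation.eval_feed, hP, E.decode_enc ha']
  simp only [(selectProgram_queryFree K J hN _).queries_eq, add_zero]
  exact P.queries_le le_rfl ha _

end Update

/-! ### The learner -/

/-- Operations that leave the points at the positions `l` on the query tape, in this order. -/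
noncomputable def arrangement (n : ℕ) (l : List (Fin n)) : List TapeAction :=
  if h : l.Nodup then
    (exists_arrangement.{u} (List.finRange n) l h fun _ _ => List.mem_finRange _).choose
  else []

theorem length_arrangement_le (n : ℕ) (l : List (Fin n)) :
    (arrangement.{u} n l).length ≤ 2 * n := by
  rw [arrangement]
  split_ifs with h
  · simpa using (exists_arrangement.{u} (List.finRange n) l h
      fun _ _ => List.mem_finRange _).choose_spec.1
  · simp

open LearnerState in
theorem performs_arrangement {X : Type u} (p : List X) {l : List (Fin p.length)} (hl : l.Nodup)
    (ω : ℕ → X) {c d : ℕ} {b : List Bool} (σ : ℕ) (hc : p.length ≤ c) (hd : b.length ≤ d) :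
    Performs ω c d (arrangement.{u} p.length l) p b σ (l.map p.get) b σ := by
  have := (exists_arrangement.{u} (List.finRange p.length) l hl
      fun _ _ => List.mem_finRange _).choose_spec.2 X p.get ω c d b σ [] (by simpa using hc) hd
  rw [arrangement, dif_pos hl]
  simpa using this

/-- The first point of a sequence outside `F` among those up to position `i`, or else the one at
position `i`. -/
noncomputable def candidate {X : Type u} (F : Set X) (y : ℕ → X) : ℕ → X
  | 0 => y 0
  | i + 1 => open Classical in if candidate F y i ∈ F then y (i + 1) else candidate F y i

/-- The points that are kept from the first `t` points of a sequence: from each block of length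
`L` the first point outside `F`, or else the last point seen. -/
noncomputable def candidates {X : Type u} (F : Set X) (L : ℕ) (y : ℕ → X) : ℕ → List X
  | 0 => []
  | t + 1 => open Classical in
      if L ∣ t then candidates F L y t ++ [y t]
      else if ∃ x ∈ (candidates F L y t).getLast?, x ∈ F then
        (candidates F L y t).dropLast ++ [y t]
      else candidates F L y t

/-! ### Rejection sampling in blocks -/

section Candidates

variable {X : Type u} (F : Set X) {L : ℕ} (y : ℕ → X)

theorem candidates_add (j i : ℕ) (hi : i < L) :
    candidates F L y (j * L + i + 1) =
      candidates F L y (j * L) ++ [candidate F (fun i => y (j * L + i)) i] := by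
  induction i with
  | zero => simp [candidates, candidate]
  | succ i ih =>
    have h : ¬ L ∣ j * L + i + 1 := by
      rw [add_assoc, Nat.dvd_add_right (Dvd.intro_left j rfl)]
      exact fun hd => absurd (Nat.le_of_dvd (Nat.succ_pos i) hd) (by omega)
    have e : j * L + (i + 1) + 1 = (j * L + i + 1) + 1 := by ring
    rw [e, candidates, if_neg h, ih (by omega)]
    simp only [List.getLast?_append, List.getLast?_singleton, candidate]
    split_ifs <;> simp_all [add_assoc]

/-- After complete blocks the kept points are the same function of disjoint stretches of the stream,
which yields their independence in `map_blocks`. -/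
theorem candidates_mul (hL : 0 < L) (j : ℕ) :
    candidates F L y (j * L) =
      (List.range j).map fun j => candidate F (fun i => y (j * L + i)) (L - 1) := by
  induction j with
  | zero => simp [candidates]
  | succ j ih =>
    have e : (j + 1) * L = j * L + (L - 1) + 1 := by
      rw [add_mul, one_mul]; omega
    rw [e, candidates_add F y j (L - 1) (by omega), ih, List.range_succ, List.map_append]
    rfl

/-- The number of kept points depends on the time alone and not on the outcomes of the tests, so the
learner can recover it from the sample counter. -/
theorem exists_candidates_eq (hL : 0 < L) {t : ℕ} (ht : 0 < t) :
    ∃ C x, candidates F L y t = C ++ [x] ∧ C.length = (t - 1) / L := by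
  have e : t = (t - 1) / L * L + (t - 1) % L + 1 := by
    have := Nat.div_add_mod' (t - 1) L
    omega
  refine ⟨candidates F L y ((t - 1) / L * L), candidate F (fun i => y ((t - 1) / L * L + i))
    ((t - 1) % L), ?_, ?_⟩
  · conv_lhs => rw [e]
    exact candidates_add F y _ _ (Nat.mod_lt _ hL)
  · rw [candidates_mul F y hL]
    simp

end Candidates

section Learner

variable {X : Type u} [MeasurableSpace X] {Q : QueryClass.{u, v} X}
  {R : InferenceRule Q} {k : ℕ} {W : LosslessCompression R k} {E : ResponseEncoding Q}
  (P : QueryProcedure E) (K : CompressionProcedure W E) (J : InferenceProcedure R E)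

/-- The operations after an update of the selected points: erase the old bits, rearrange the
points, write the new bits, and draw a point. -/
noncomputable def updateActions (n b : ℕ) (s : List (Fin n) × List (Fin n) × List Bool) :
    List TapeAction :=
  List.replicate b .erase ++ arrangement.{u} n (s.1 ++ s.2.1) ++ s.2.2.map .write ++ [.sample]

open Classical in
/-- The learner that draws `6 k` points and then, in each of `T` rounds, selects at most `2 k`
points by `updateProgram` and collects `4 k` new points. Each of these is the first one, among
`L` points that are drawn, that is not inferred from the selected points. -/
noncomputable def rpuLearner (L T : ℕ) : Learner Q where
  step n b σ _ :=
    if σ < 6 * k then .ret (some [.sample])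
    -- The inequality is strict because at equality one last update is due, after the `T` rounds.
    else if T * (4 * k * L) < σ - 6 * k then .ret none
    else if 4 * k * L ∣ σ - 6 * k then
      ((updateProgram P K J (6 * k) n).feed []).bind fun r =>
        .ret (r.map (updateActions.{u} n b))
    else if L ∣ σ - 6 * k then .ret (some [.sample])
    -- The clock gives the number of points kept so far in this round. Subtracting it and the `k`
    -- points of the first group from the tape length leaves the size of the second group.
    else if hn : k + (n - k - (((σ - 6 * k - 1) % (4 * k * L)) / L + 1)) < n then
      (lookupProgram J k _ hn).bind fun r =>
        -- The tested point is the last one on the tape. If it is inferred, the next draw replaces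
        -- it; otherwise the next draw is made and discarded, to advance the clock.
        .ret (some (if r.isSome then [.forget (n - 1), .sample] else [.sample, .forget n]))
    else .ret none
  out l w x :=
    -- The surplus point drawn in the last update gives its place to `x`. The lookup asks no
    -- queries, so any element of `Q.Answers` serves to evaluate it.
    if hn : k + ((l.dropLast ++ [x]).length - k - 1) < (l.dropLast ++ [x]).length ∧
        Nonempty Q.Answers then
      (lookupProgram J k _ hn.1).eval (l.dropLast ++ [x]).get w hn.2.some
    else none

/-- The points at the selected positions. -/
def chosen {Y : Type*} {n : ℕ} (f : Fin n → Y) :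
    Option (List (Fin n) × List (Fin n) × List Bool) → List Y
  | some s => (s.1 ++ s.2.1).map f
  | none => []

/-- The points that remain from the tape contents `l` after an update. -/
noncomputable def selected (a : Q.Answers) (l : List X) : List X :=
  chosen l.get ((updateProgram P K J (6 * k) l.length).eval l.get [] a)

/-- The points on the query tape before the update in round `r`. -/
noncomputable def roundSample (a a' : Q.Answers) (h : Q.Hyp) (L : ℕ) (ω : ℕ → X) : ℕ → List X
  | 0 => (List.range (6 * k)).map ω
  | r + 1 => selected P K J a (roundSample a a' h L ω r) ++
      candidates (coveredByClass R a' h (roundSample a a' h L ω r)) L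
        (fun i => ω (6 * k + r * (4 * k * L) + i)) (4 * k * L)

end Learner

/-! ### Runs of a learner that draws one point in every step -/

section Run

variable {X : Type u} [MeasurableSpace X] {Q : QueryClass.{u, v} X}

/-- The tapes, the counters, and bounds on the resources after `n` steps that each draw a
point. -/
structure RunsTo (A : Learner Q) (cost : CostModel X) (a : Q.Answers) (ω : ℕ → X) (c d n : ℕ)
    (l : List X) (w : List Bool) (t q : ℝ≥0∞) : Prop where
  halted : (A.state cost a ω n).halted = false
  samples : (A.state cost a ω n).samples = n
  points : (A.state cost a ω n).points = l
  bits : (A.state cost a ω n).bits = w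
  peakPoints : (A.state cost a ω n).peakPoints ≤ c
  peakBits : (A.state cost a ω n).peakBits ≤ d
  time : (A.state cost a ω n).time ≤ t
  queries : ((A.state cost a ω n).queries : ℝ≥0∞) ≤ q

variable {A : Learner Q} {cost : CostModel X} {a : Q.Answers} {ω : ℕ → X} {c d n : ℕ}
  {l l' : List X} {w w' : List Bool} {t q t' q' : ℝ≥0∞}

theorem RunsTo.start : RunsTo A cost a ω c d 0 [] [] 0 0 := by
  constructor <;> simp [Learner.state, LearnerState.start]

theorem RunsTo.step (hr : RunsTo A cost a ω c d n l w t q)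
    {f : TapeComputation Q l.length (Option (List TapeAction))} {s : List TapeAction}
    (hf : ∀ m, A.step l.length w.length n m = f)
    (hs : f.eval l.get w a = some s)
    (hperf : LearnerState.Performs ω c d s l w n l' w' (n + 1))
    (ht : f.time cost l.get w a + s.length ≤ t')
    (hq : (f.queries l.get w a : ℝ≥0∞) ≤ q') :
    RunsTo A cost a ω c d (n + 1) l' w' (t + t') (q + q') := by
  obtain ⟨h1, h2, h3, h4, h5, h6, h7, h8⟩ := hr
  have hst : A.state cost a ω (n + 1) = A.next cost a ω (A.state cost a ω n) :=
    Function.iterate_succ_apply' ..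
  rcases hS : A.state cost a ω n with ⟨pts, bits, sam, qu, tm, pp, pb, hal⟩
  rw [hS] at h1 h2 h3 h4 h5 h6 h7 h8 hst
  simp only at h1 h2 h3 h4 h5 h6 h7 h8
  subst h1 h2 h3 h4
  have hnext : A.next cost a ω ⟨pts, bits, sam, qu, tm, pp, pb, false⟩ =
      s.foldl (LearnerState.perform ω) ⟨pts, bits, sam, qu + f.queries pts.get bits a,
        tm + f.time cost pts.get bits a, pp, pb, false⟩ := by
    simp only [Learner.next, hf, hs, Bool.false_eq_true, if_false]
  obtain ⟨g1, g2, g3, g4, g5, g6, g7, g8⟩ := hperf ⟨pts, bits, sam, qu + f.queries pts.get bits a,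
        tm + f.time cost pts.get bits a, pp, pb, false⟩ rfl rfl rfl h5 h6
  rw [← hnext, ← hst] at g1 g2 g3 g4 g5 g6 g7 g8
  refine ⟨g5, g3, g1, g2, g7, g8, ?_, ?_⟩
  · rw [g6]
    simp only [add_assoc]
    exact add_le_add h7 ht
  · rw [g4]
    push_cast
    exact add_le_add h8 hq

theorem RunsTo.mono (hr : RunsTo A cost a ω c d n l w t q) (ht : t ≤ t') (hq : q ≤ q') :
    RunsTo A cost a ω c d n l w t' q' :=
  ⟨hr.halted, hr.samples, hr.points, hr.bits, hr.peakPoints, hr.peakBits, hr.time.trans ht,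
    hr.queries.trans hq⟩

/-- Halted states are fixed, so any time at which the learner has halted shows the final state. -/
theorem final_eq_of_halted {m : ℕ} (hm : (A.state cost a ω m).halted = true) :
    A.final cost a ω = A.state cost a ω m := by
  have hstable : ∀ i j, (A.state cost a ω i).halted = true →
      A.state cost a ω (i + j) = A.state cost a ω i := by
    intro i j hi
    induction j with
    | zero => rfl
    | succ j ih =>
      have : A.state cost a ω (i + (j + 1)) = A.next cost a ω (A.state cost a ω (i + j)) :=
        Function.iterate_succ_apply' ..
      rw [this, ih, Learner.next, if_pos hi]
  have h0 : (A.state cost a ω (sInf {N | (A.state cost a ω N).halted = true})).halted = true :=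
    Nat.sInf_mem (s := {N | (A.state cost a ω N).halted = true}) ⟨m, hm⟩
  have hle : sInf {N | (A.state cost a ω N).halted = true} ≤ m := Nat.sInf_le hm
  obtain ⟨j, hj⟩ := Nat.exists_eq_add_of_le hle
  rw [Learner.final, hj, hstable _ _ h0]

/-- The state after the learner halts. -/
theorem RunsTo.final (hr : RunsTo A cost a ω c d n l w t q)
    (hf : ∀ m, A.step l.length w.length n m = .ret none) :
    A.Halts cost a ω ∧ (A.final cost a ω).points = l ∧ (A.final cost a ω).bits = w ∧
      (A.final cost a ω).peakPoints ≤ c ∧ (A.final cost a ω).peakBits ≤ d ∧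
      (A.final cost a ω).time ≤ t + 1 ∧ ((A.final cost a ω).queries : ℝ≥0∞) ≤ q := by
  obtain ⟨h1, h2, h3, h4, h5, h6, h7, h8⟩ := hr
  have hst : A.state cost a ω (n + 1) = A.next cost a ω (A.state cost a ω n) :=
    Function.iterate_succ_apply' ..
  rcases hS : A.state cost a ω n with ⟨pts, bits, sam, qu, tm, pp, pb, hal⟩
  rw [hS] at h1 h2 h3 h4 h5 h6 h7 h8 hst
  simp only at h1 h2 h3 h4 h5 h6 h7 h8
  subst h1 h2 h3 h4
  have hnext : A.next cost a ω ⟨pts, bits, sam, qu, tm, pp, pb, false⟩ =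
      ⟨pts, bits, sam, qu, tm + 1, pp, pb, true⟩ := by
    simp only [Learner.next, hf, TapeComputation.eval, TapeComputation.time,
      TapeComputation.queries, Bool.false_eq_true, if_false, add_zero]
  rw [hnext] at hst
  have hh : (A.state cost a ω (sam + 1)).halted = true := by rw [hst]
  rw [final_eq_of_halted hh, hst]
  exact ⟨⟨sam + 1, hh⟩, rfl, rfl, h5, h6, add_le_add h7 le_rfl, h8⟩

end Run

/-! ### Tape contents and resources during a round -/

section Invariants

variable {X : Type u} [MeasurableSpace X] {Q : QueryClass.{u, v} X}
  {R : InferenceRule Q} {k : ℕ} {W : LosslessCompression R k} {E : ResponseEncoding Q}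
  (P : QueryProcedure E) (K : CompressionProcedure W E) (J : InferenceProcedure R E)
  {h : Q.Hyp} {a a' : Q.Answers} (cost : CostModel X)

/-- Bound on the time of an update. -/
noncomputable def updateCost : ℝ≥0∞ :=
  P.worstTime cost (7 * k) +
    ((6 * k : ℕ) * (J.worstTime cost k + 2) + 2 * K.worstTime cost (7 * k) + 4) + 1 +
    ((4 * E.maxBits (7 * k) + 12 * k + 1 : ℕ) : ℝ≥0∞)

/-- Bound on the time of a step that tests a point. -/
noncomputable def testCost (k : ℕ) : ℝ≥0∞ :=
  2 * J.worstTime cost k + 4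

section Selected

variable (hP : ∀ S : Fin (6 * k) → X, (P.prog (6 * k)).eval S [] a = E.enc _ (Q.table a' S))

include hP in
theorem exists_selected_eq (ha' : Q.IsValid h a') (hk : 1 ≤ k) {l : List X}
    (h2 : 2 * k ≤ l.length) (h6 : l.length ≤ 6 * k) :
    ∃ (A B : List X) (s : List (Fin l.length) × List (Fin l.length) × List Bool),
      (updateProgram P K J (6 * k) l.length).eval l.get [] a = some s ∧
      (s.1 ++ s.2.1).Nodup ∧ (s.1 ++ s.2.1).map l.get = A ++ B ∧
      s.2.2 = E.listBits a' A ++ E.listBits a' B ∧ selected P K J a l = A ++ B ∧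
      A.length = k ∧ B.length ≤ k ∧
      covered R a' A ∪ covered R a' B = coveredByClass R a' h l ∧
      coveredByClass R a' h (A ++ B) = coveredByClass R a' h l := by
  obtain ⟨A, B, h1, hA, hB, hnd, hc, hc'⟩ :=
    eval_updateProgram (h := h) (R := R) (W := W) P K J l.get [] hP ha' (by omega) h6 h2
  rw [List.ofFn_get] at hc hc'
  refine ⟨A.map l.get, B.map l.get, _, h1, hnd, by simp, rfl, ?_, by simpa, by simpa, hc, ?_⟩
  · rw [selected, h1]; simp [chosen]
  · rw [← List.map_append, hc']

variable {ω : ℕ → X} {L T : ℕ}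

-- A later sample consists of `k` points, at most `k` further ones, and `4 k` candidates. The lower
-- bound is what `eval_selectProgram` needs; the upper bound lets the sample be padded to `6 k`.
include hP in
theorem length_roundSample (ha' : Q.IsValid h a') (hk : 1 ≤ k) (hL : 0 < L) (r : ℕ) :
    2 * k ≤ (roundSample P K J a a' h L ω r).length ∧
      (roundSample P K J a a' h L ω r).length ≤ 6 * k := by
  induction r with
  | zero => simp [roundSample]; omega
  | succ r ih =>
    obtain ⟨A, B, s, -, -, -, -, hs, hA, hB, -, -⟩ :=
      exists_selected_eq (R := R) (W := W) P K J hP ha' hk ih.1 ih.2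
    rw [roundSample, hs, candidates_mul _ _ hL]
    simp
    omega

end Selected

variable {ω : ℕ → X} {L T : ℕ}

theorem runsTo_init (n : ℕ) (hn : n ≤ 6 * k) :
    RunsTo (rpuLearner P K J L T) cost a ω (7 * k) (2 * E.maxBits (7 * k)) n
      ((List.range n).map ω) [] (2 * n) 0 := by
  induction n with
  | zero => simpa using RunsTo.start
  | succ n ih =>
    refine ((ih (by omega)).step (f := .ret (some [.sample])) (s := [.sample]) (t' := 2)
      (q' := 0) ?_ rfl ?_ ?_ ?_).mono ?_ ?_
    · intro m
      simp only [rpuLearner, List.length_nil]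
      rw [if_pos (by omega)]
    · rw [List.range_succ, List.map_append]
      exact LearnerState.Performs.sample (by simp; omega) (by simp)
    · simp [TapeComputation.time, one_add_one_eq_two]
    · simp [TapeComputation.queries]
    · push_cast; rw [mul_add, mul_one]
    · simp

variable (hP : ∀ S : Fin (6 * k) → X, (P.prog (6 * k)).eval S [] a = E.enc _ (Q.table a' S))

include hP

theorem runsTo_update (ha : Q.IsValid h a) (ha' : Q.IsValid h a') (hk : 1 ≤ k)
    {l A B : List X} {w : List Bool} {t q : ℝ≥0∞} {r : ℕ} (hr : r ≤ T)
    (hrun : RunsTo (rpuLearner P K J L T) cost a ω (7 * k) (2 * E.maxBits (7 * k))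
      (6 * k + r * (4 * k * L)) l w t q)
    (h2 : 2 * k ≤ l.length) (h6 : l.length ≤ 6 * k) (hw : w.length ≤ 2 * E.maxBits (7 * k))
    {s : List (Fin l.length) × List (Fin l.length) × List Bool}
    (hs : (updateProgram P K J (6 * k) l.length).eval l.get [] a = some s)
    (hnd : (s.1 ++ s.2.1).Nodup) (hAB : (s.1 ++ s.2.1).map l.get = A ++ B)
    (hbits : s.2.2 = E.listBits a' A ++ E.listBits a' B) (hA : A.length ≤ k)
    (hB : B.length ≤ k) :
    RunsTo (rpuLearner P K J L T) cost a ω (7 * k) (2 * E.maxBits (7 * k))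
      (6 * k + r * (4 * k * L) + 1) (A ++ B ++ [ω (6 * k + r * (4 * k * L))])
      (E.listBits a' A ++ E.listBits a' B) (t + updateCost P K J cost)
      (q + P.numQueries (6 * k)) := by
  have hbA : (E.listBits a' A).length ≤ E.maxBits (7 * k) := by
    rw [E.length_listBits]; exact E.bits_le_maxBits (by omega)
  have hbB : (E.listBits a' B).length ≤ E.maxBits (7 * k) := by
    rw [E.length_listBits]; exact E.bits_le_maxBits (by omega)
  have hbl : s.2.2.length ≤ 2 * E.maxBits (7 * k) := by
    rw [hbits, List.length_append]; omega
  refine hrun.step (f := ((updateProgram P K J (6 * k) l.length).feed []).bind fun r =>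
        .ret (r.map (updateActions.{u} l.length w.length)))
    (s := updateActions.{u} l.length w.length s) ?_ ?_ ?_ ?_ ?_
  · intro m
    simp only [rpuLearner]
    rw [if_neg (by omega), if_neg ?_, if_pos ?_]
    · rw [Nat.add_sub_cancel_left]; exact Dvd.intro_left r rfl
    · rw [Nat.add_sub_cancel_left, not_lt]; exact Nat.mul_le_mul_right _ hr
  · rw [TapeComputation.eval_bind, TapeComputation.eval_feed, hs]
    rfl
  · have hAl : (A ++ B).length ≤ 2 * k := by simp; omega
    refine (((LearnerState.Performs.erases (by omega) hw).append
      (performs_arrangement l hnd ω _ (by omega) (by simp))).append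
      (LearnerState.Performs.writes (s.2.2) ?_ ?_)).append ?_
    · rw [hAB]; omega
    · simpa using hbl
    · rw [hAB, List.nil_append, hbits]
      rw [hbits] at hbl
      exact LearnerState.Performs.sample (by omega) hbl
  · have hlen : (updateActions.{u} l.length w.length s).length ≤
        4 * E.maxBits (7 * k) + 12 * k + 1 := by
      have := length_arrangement_le.{u} l.length (s.1 ++ s.2.1)
      simp only [updateActions, List.length_append, List.length_replicate, List.length_map,
        List.length_singleton]
      omega
    refine add_le_add ((TapeComputation.time_bind_le ..).trans (add_le_add
      ((TapeComputation.time_feed_le ..).trans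
        ((time_updateProgram_le P K J cost l.get [] hP hk ha ha' (by omega) h6
          (by omega : 6 * k ≤ 7 * k)).trans ?_)) le_rfl)) (by exact_mod_cast hlen)
    gcongr
  · rw [TapeComputation.queries_bind, TapeComputation.queries_feed]
    simp only [TapeComputation.queries, add_zero]
    exact queries_updateProgram_le P K J l.get [] hP ha ha' (by omega) h6

-- Induction on the draws of a round, with three cases: a new block starts, the current candidate is
-- inferred and replaced, or it is kept and the new draw discarded. The responses on `A` and `B`
-- stay on the work tape, so no query is needed.
omit hP in
theorem runsTo_collect (ha' : Q.IsValid h a') (hk : 1 ≤ k) (hL : 0 < L)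
    {A B : List X} {F : Set X} {t q : ℝ≥0∞} {r : ℕ} (hr : r < T)
    (hrun : RunsTo (rpuLearner P K J L T) cost a ω (7 * k) (2 * E.maxBits (7 * k))
      (6 * k + r * (4 * k * L) + 1) (A ++ B ++ [ω (6 * k + r * (4 * k * L))])
      (E.listBits a' A ++ E.listBits a' B) t q)
    (hA : A.length = k) (hB : B.length ≤ k) (hF : covered R a' A ∪ covered R a' B = F)
    (i : ℕ) (hi : i < 4 * k * L) :
    RunsTo (rpuLearner P K J L T) cost a ω (7 * k) (2 * E.maxBits (7 * k))
      (6 * k + r * (4 * k * L) + (i + 1))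
      (A ++ B ++ candidates F L (fun i => ω (6 * k + r * (4 * k * L) + i)) (i + 1))
      (E.listBits a' A ++ E.listBits a' B) (t + i * testCost J cost k) q := by
  classical
  set y := fun i => ω (6 * k + r * (4 * k * L) + i) with hy
  have hbl : (E.listBits a' A ++ E.listBits a' B).length ≤ 2 * E.maxBits (7 * k) := by
    have h1 := E.bits_le_maxBits (by omega : A.length ≤ 7 * k)
    have h2 := E.bits_le_maxBits (by omega : B.length ≤ 7 * k)
    rw [List.length_append, E.length_listBits, E.length_listBits]
    omega
  induction i with
  | zero => simpa [candidates, hy] using hrun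
  | succ i ih =>
    obtain ⟨C, x, hCx, hClen⟩ := exists_candidates_eq F y hL (Nat.succ_pos i)
    rw [Nat.succ_eq_add_one] at hCx
    simp only [Nat.succ_eq_add_one, Nat.add_sub_cancel] at hClen
    have hClt : C.length < 4 * k := by
      rw [hClen]; exact Nat.div_lt_of_lt_mul (by rw [mul_comm L]; omega)
    have ih := ih (by omega)
    have hτ : 6 * k + r * (4 * k * L) + (i + 1) - 6 * k = r * (4 * k * L) + (i + 1) := by omega
    have hend : ¬ T * (4 * k * L) < r * (4 * k * L) + (i + 1) := by
      have := Nat.mul_le_mul_right (4 * k * L) (Nat.succ_le_of_lt hr)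
      rw [Nat.succ_mul] at this
      omega
    have hndvd : ¬ 4 * k * L ∣ r * (4 * k * L) + (i + 1) := by
      rw [Nat.dvd_add_right (Dvd.intro_left r rfl)]
      exact fun hd => absurd (Nat.le_of_dvd (Nat.succ_pos i) hd) (by omega)
    have hdvd : L ∣ r * (4 * k * L) + (i + 1) ↔ L ∣ i + 1 :=
      Nat.dvd_add_right ⟨r * (4 * k), by ring⟩
    have hω : ω (6 * k + r * (4 * k * L) + (i + 1)) = y (i + 1) := rfl
    have hq : q = q + 0 := (add_zero q).symm
    have ht : t + ((i + 1 : ℕ) : ℝ≥0∞) * testCost J cost k =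
        t + i * testCost J cost k + testCost J cost k := by push_cast; ring
    rw [ht, hq]
    by_cases hd : L ∣ i + 1
    · rw [hCx] at ih
      refine ih.step (f := .ret (some [.sample])) (s := [.sample]) ?_ rfl ?_ ?_ ?_
      · intro m
        simp only [rpuLearner]
        rw [hτ, if_neg (by omega), if_neg hend, if_neg hndvd, if_pos (hdvd.2 hd)]
      · rw [candidates, if_pos hd, hCx, ← hω, ← List.append_assoc (A ++ B) (C ++ [x])]
        exact LearnerState.Performs.sample (by simp; omega) hbl
      · simp only [TapeComputation.time, testCost, List.length_singleton, Nat.cast_one]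
        refine le_trans ?_ le_add_self
        norm_num
      · simp [TapeComputation.queries]
    · have hcand : candidates F L y (i + 1 + 1) =
          if x ∈ F then C ++ [y (i + 1)] else C ++ [x] := by
        rw [candidates, if_neg hd, hCx]
        simp
      rw [hCx, ← List.append_assoc] at ih
      rw [hcand]
      set l := A ++ B ++ C ++ [x] with hl
      have hll : l.length = k + B.length + C.length + 1 := by simp [hl, hA, add_assoc]
      have hmod : (r * (4 * k * L) + (i + 1) - 1) % (4 * k * L) = i := by
        rw [← Nat.add_assoc, Nat.add_sub_cancel, Nat.add_comm, Nat.add_mul_mod_self_right]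
        exact Nat.mod_eq_of_lt (by omega)
      have hm : l.length - k - (((r * (4 * k * L) + (i + 1) - 1) % (4 * k * L)) / L + 1) =
          B.length := by
        rw [hmod, ← hClen]; omega
      have hlt : A.length + B.length < l.length := by omega
      have hev := eval_lookupProgram (a := a) l.get J ha' (List.ofFn_get l) hlt hF
      have htm := time_lookupProgram_le (a := a) (k := k) cost l.get J ha' (List.ofFn_get l) hlt
        hA.le hB
      refine ih.step (f := (lookupProgram J A.length B.length hlt).bind fun r =>
        .ret (some (if r.isSome then [.forget (l.length - 1), .sample]
          else [.sample, .forget l.length])))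
        (s := if x ∈ F then [.forget (l.length - 1), .sample]
          else [.sample, .forget l.length]) ?_ ?_ ?_ ?_ ?_
      · intro m
        simp only [rpuLearner]
        rw [hτ, if_neg (by omega), if_neg hend, if_neg hndvd, if_neg (mt hdvd.1 hd)]
        have hlt' : k + (l.length - k -
            (((r * (4 * k * L) + (i + 1) - 1) % (4 * k * L)) / L + 1)) < l.length := by
          rw [hm]; omega
        rw [dif_pos hlt']
        congr! 2
        exact hA.symm
      · rw [TapeComputation.eval_bind, hev]
        by_cases hx : x ∈ F <;> simp [hx, TapeComputation.eval]
      · split_ifs with hx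
        · have e : l.eraseIdx (l.length - 1) = A ++ B ++ C := by
            rw [List.eraseIdx_length_sub_one, hl, List.dropLast_concat]
          have h1 := LearnerState.Performs.forget (ω := ω) (p := l)
            (σ := 6 * k + r * (4 * k * L) + (i + 1)) (c := 7 * k) (l.length - 1) (by omega) hbl
          have h2 := h1.append (LearnerState.Performs.sample
            (by rw [e]; simp; omega) hbl)
          rw [e, hω, List.append_assoc (A ++ B) C] at h2
          exact h2
        -- Drawing before discarding puts up to `6 k + 1 ≤ 7 k` points on the tape.
        · have h1 := LearnerState.Performs.sample (ω := ω) (p := l)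
            (σ := 6 * k + r * (4 * k * L) + (i + 1)) (c := 7 * k) (by omega) hbl
          have h2 := h1.append (LearnerState.Performs.forget (ω := ω) l.length
            (by simp; omega) hbl)
          have e : (l ++ [ω (6 * k + r * (4 * k * L) + (i + 1))]).eraseIdx l.length =
              A ++ B ++ (C ++ [x]) := by
            rw [List.eraseIdx_append_of_length_le le_rfl]
            simp [hl]
          rw [e] at h2
          exact h2
      · have hs2 : (if x ∈ F then [TapeAction.forget (l.length - 1), .sample]
          else [.sample, .forget l.length]).length = 2 := by split_ifs <;> rfl
        rw [hs2]
        refine (add_le_add ((TapeComputation.time_bind_le ..).trans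
          (add_le_add htm le_rfl)) le_rfl).trans_eq ?_
        simp only [TapeComputation.time, testCost]
        push_cast
        ring
      · rw [TapeComputation.queries_bind, (lookupProgram_queryFree J _ _ hlt).queries_eq]
        simp [TapeComputation.queries]

end Invariants

/-! ### The complete run -/

section Outcome

variable {X : Type u} [MeasurableSpace X] {Q : QueryClass.{u, v} X}
  {R : InferenceRule Q} {k : ℕ} {W : LosslessCompression R k} {E : ResponseEncoding Q}
  (P : QueryProcedure E) (K : CompressionProcedure W E) (J : InferenceProcedure R E)
  {h : Q.Hyp} {a a' : Q.Answers} (cost : CostModel X)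
  (hP : ∀ S : Fin (6 * k) → X, (P.prog (6 * k)).eval S [] a = E.enc _ (Q.table a' S))
  {ω : ℕ → X} {L T : ℕ}

include hP

theorem runsTo_round (ha : Q.IsValid h a) (ha' : Q.IsValid h a') (hk : 1 ≤ k) (hL : 0 < L)
    (r : ℕ) (hr : r ≤ T) :
    ∃ w, w.length ≤ 2 * E.maxBits (7 * k) ∧
      RunsTo (rpuLearner P K J L T) cost a ω (7 * k) (2 * E.maxBits (7 * k))
        (6 * k + r * (4 * k * L)) (roundSample P K J a a' h L ω r) w
        (2 * (6 * k : ℕ) +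
          r * (updateCost P K J cost + (4 * k * L : ℕ) * testCost J cost k))
        (r * P.numQueries (6 * k)) := by
  induction r with
  | zero =>
    refine ⟨[], by simp, (by simpa [roundSample] using runsTo_init P K J cost (6 * k) le_rfl)⟩
  | succ r ih =>
    obtain ⟨w, hw, hrun⟩ := ih (by omega)
    obtain ⟨h2, h6⟩ := length_roundSample (ω := ω) (R := R) (W := W) P K J hP ha' hk hL r
    obtain ⟨A, B, s, hs, hnd, hAB, hbits, hsel, hA, hB, hcov, -⟩ :=
      exists_selected_eq P K J hP ha' hk h2 h6
    have h1 := runsTo_update P K J cost hP ha ha' hk (by omega) hrun h2 h6 hw hs hnd hAB hbits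
      hA.le hB
    have hM : 0 < 4 * k * L := by positivity
    -- The update has already drawn the first point of the round, so one step fewer remains.
    have h3 := runsTo_collect P K J cost ha' hk hL (by omega) h1 hA hB hcov (4 * k * L - 1)
      (by omega)
    rw [Nat.sub_add_cancel hM, ← hsel] at h3
    have hclock : 6 * k + (r + 1) * (4 * k * L) = 6 * k + r * (4 * k * L) + 4 * k * L := by ring
    rw [hclock]
    refine ⟨_, ?_, h3.mono ?_ ?_⟩
    · have h1 := E.bits_le_maxBits (by omega : A.length ≤ 7 * k)
      have h2 := E.bits_le_maxBits (by omega : B.length ≤ 7 * k)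
      rw [List.length_append, E.length_listBits, E.length_listBits]
      omega
    · have : ((4 * k * L - 1 : ℕ) : ℝ≥0∞) * testCost J cost k ≤
          (4 * k * L : ℕ) * testCost J cost k := by
        gcongr
        omega
      refine (add_le_add le_rfl this).trans_eq ?_
      push_cast
      ring
    · push_cast
      rw [add_mul, one_mul]

-- The final update compresses without changing the coverage, so the classifier is described by the
-- sample before it. Reliability is then immediate, and usefulness becomes a statement about
-- `roundSample`.
open Classical in
theorem rpuLearner_outcome (ha : Q.IsValid h a) (ha' : Q.IsValid h a') (hk : 1 ≤ k)
    (hL : 0 < L) :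
    (rpuLearner P K J L T).Halts cost a ω ∧
    (∀ x, (rpuLearner P K J L T).classifier cost a ω x =
      if x ∈ coveredByClass R a' h (roundSample P K J a a' h L ω T) then
        some (Q.label h x) else none) ∧
    ((rpuLearner P K J L T).final cost a ω).peakPoints ≤ 7 * k ∧
    ((rpuLearner P K J L T).final cost a ω).peakBits ≤ 2 * E.maxBits (7 * k) ∧
    ((rpuLearner P K J L T).final cost a ω).time ≤ 2 * (6 * k : ℕ) +
      T * (updateCost P K J cost + (4 * k * L : ℕ) * testCost J cost k) +
      updateCost P K J cost + 1 ∧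
    (((rpuLearner P K J L T).final cost a ω).queries : ℝ≥0∞) ≤
      T * P.numQueries (6 * k) + P.numQueries (6 * k) := by
  obtain ⟨w, hw, hrun⟩ := runsTo_round (ω := ω) (T := T) P K J cost hP ha ha' hk hL T le_rfl
  obtain ⟨h2, h6⟩ := length_roundSample (ω := ω) (R := R) (W := W) P K J hP ha' hk hL T
  obtain ⟨A, B, s, hs, hnd, hAB, hbits, hsel, hA, hB, hcov, -⟩ :=
    exists_selected_eq P K J hP ha' hk h2 h6
  have h1 := runsTo_update P K J cost hP ha ha' hk le_rfl hrun h2 h6 hw hs hnd hAB hbits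
    hA.le hB
  obtain ⟨g1, g2, g3, g4, g5, g6, g7⟩ := h1.final fun m => by
    simp only [rpuLearner]
    rw [if_neg (by omega), if_pos (by omega)]
  refine ⟨g1, fun x => ?_, g4, g5, g6, g7⟩
  set l := A ++ B ++ [x] with hl
  have hll : l.length = k + B.length + 1 := by simp [hl, hA, add_assoc]
  have hlt : A.length + B.length < l.length := by omega
  have hm : l.length - k - 1 = B.length := by omega
  have hlt' : k + (l.length - k - 1) < l.length := by omega
  have hout : (rpuLearner P K J L T).classifier cost a ω x =
      (lookupProgram J k (l.length - k - 1) hlt').eval l.get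
        (E.listBits a' A ++ E.listBits a' B) (Nonempty.intro a).some := by
    have aux : ∀ l', l' = l →
        (if hn : k + (l'.length - k - 1) < l'.length ∧ Nonempty Q.Answers then
          (lookupProgram J k _ hn.1).eval l'.get (E.listBits a' A ++ E.listBits a' B) hn.2.some
        else none) = (lookupProgram J k (l.length - k - 1) hlt').eval l.get
          (E.listBits a' A ++ E.listBits a' B) (Nonempty.intro a).some := by
      rintro _ rfl
      rw [dif_pos (⟨hlt', ⟨a⟩⟩ : _ ∧ Nonempty Q.Answers)]
    rw [Learner.classifier, g2, g3]
    exact aux _ (by rw [List.dropLast_concat])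
  rw [hout, ← eval_lookupProgram (a := (Nonempty.intro a).some) (C := []) (x := x) l.get J ha'
    (by rw [List.ofFn_get, hl, List.append_nil]) hlt hcov]
  congr! 2
  exact hA.symm

end Outcome

/-! ### Streams of independent points -/

section Stream

variable {X : Type u}

/-- The first `N` entries of a sequence, followed by another sequence. -/
def splice (N : ℕ) (p : (ℕ → X) × (ℕ → X)) : ℕ → X :=
  fun i => if i < N then p.1 i else p.2 (i - N)

theorem splice_of_lt {N i : ℕ} (p : (ℕ → X) × (ℕ → X)) (hi : i < N) :
    splice N p i = p.1 i := if_pos hi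

theorem splice_add (N i : ℕ) (p : (ℕ → X) × (ℕ → X)) : splice N p (N + i) = p.2 i := by
  simp [splice]

theorem candidate_congr (F : Set X) {y y' : ℕ → X} {i : ℕ} (h : ∀ j ≤ i, y j = y' j) :
    candidate F y i = candidate F y' i := by
  induction i with
  | zero => exact h 0 le_rfl
  | succ i ih =>
    rw [candidate, candidate, ih fun j hj => h j (by omega), h (i + 1) le_rfl]

variable [MeasurableSpace X]

theorem measurable_splice (N : ℕ) : Measurable (splice N : (ℕ → X) × (ℕ → X) → ℕ → X) := by
  refine measurable_pi_lambda _ fun i => ?_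
  by_cases hi : i < N
  · simp only [splice, hi, if_true]
    exact (measurable_pi_apply i).comp measurable_fst
  · simp only [splice, hi, if_false]
    exact (measurable_pi_apply _).comp measurable_snd

theorem measurable_candidate {F : Set X} (hF : MeasurableSet F) (i : ℕ) :
    Measurable fun y : ℕ → X => candidate F y i := by
  classical
  induction i with
  | zero => exact measurable_pi_apply 0
  | succ i ih =>
    simp only [candidate]
    exact Measurable.ite (ih hF) (measurable_pi_apply _) ih

variable (D : Measure X) [IsProbabilityMeasure D]

/-- The distribution of a stream of independent points. -/
noncomputable abbrev streamMeasure : Measure (ℕ → X) := Measure.infinitePi fun _ => D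

/-- A box in the sequence space splits at index `N` into a product of two boxes. This expresses the
independence of past and future draws in a form suitable for Fubini's theorem. -/
theorem measurePreserving_splice (N : ℕ) :
    MeasurePreserving (splice N) ((streamMeasure D).prod (streamMeasure D)) (streamMeasure D) := by
  refine ⟨measurable_splice N, Measure.eq_infinitePi _ fun s t ht => ?_⟩
  rw [Measure.map_apply (measurable_splice N)
    (MeasurableSet.pi s.countable_toSet fun i _ => ht i)]
  have hpre : splice N ⁻¹' (s : Set ℕ).pi t =
      ((s.filter (· < N) : Finset ℕ) : Set ℕ).pi t ×ˢ
      (((s.filter (¬ · < N)).image (· - N) : Finset ℕ) : Set ℕ).pi fun i => t (N + i) := by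
    ext p
    simp only [Set.mem_preimage, Set.mem_pi, Set.mem_prod, Finset.coe_filter, Finset.coe_image,
      Finset.mem_coe]
    constructor
    · refine fun hp => ⟨fun i hi => ?_, ?_⟩
      · rw [← splice_of_lt p hi.2]
        exact hp i hi.1
      · rintro _ ⟨i, hi, rfl⟩
        have e : N + (i - N) = i := by have := not_lt.1 hi.2; omega
        have := hp i hi.1
        rw [← e, splice_add, e] at this
        simpa only [e] using this
    · rintro ⟨h1, h2⟩ i hi
      by_cases hiN : i < N
      · rw [splice_of_lt p hiN]
        exact h1 i ⟨hi, hiN⟩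
      · have e : N + (i - N) = i := by omega
        have := h2 (i - N) ⟨i, ⟨hi, hiN⟩, rfl⟩
        rw [← splice_add N, e] at this
        exact this
  rw [hpre, Measure.prod_prod, Measure.infinitePi_pi _ fun i _ => ht i,
    Measure.infinitePi_pi _ fun i _ => ht _, Finset.prod_image,
    ← Finset.prod_filter_mul_prod_filter_not s (· < N)]
  · congr 1
    refine Finset.prod_congr rfl fun i hi => ?_
    have := not_lt.1 (Finset.mem_filter.1 hi).2
    rw [Nat.add_sub_cancel' this]
  · intro i hi j hj hij
    have h1 := not_lt.1 (Finset.mem_filter.1 hi).2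
    have h2 := not_lt.1 (Finset.mem_filter.1 hj).2
    simp only at hij
    omega

theorem streamMeasure_eq_prod (N : ℕ) {s : Set (ℕ → X)} (hs : MeasurableSet s) :
    streamMeasure D s = (streamMeasure D).prod (streamMeasure D) (splice N ⁻¹' s) :=
  ((measurePreserving_splice D N).measure_preimage hs.nullMeasurableSet).symm

/-- The distribution of the first point of a stream outside `F` among the first `i + 1` points,
or else of the last of these. -/
noncomputable def candidateLaw (F : Set X) (i : ℕ) : Measure X :=
  (streamMeasure D).map fun y => candidate F y i

variable {F : Set X}

theorem streamMeasure_eval_zero {s : Set X} (hs : MeasurableSet s) :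
    streamMeasure D ((fun y => y 0) ⁻¹' s) = D s :=
  (measurePreserving_eval_infinitePi (fun _ : ℕ => D) 0).measure_preimage hs.nullMeasurableSet

omit [MeasurableSpace X] in
theorem candidate_splice_succ (i : ℕ) (p : (ℕ → X) × (ℕ → X)) :
    candidate F (splice (i + 1) p) (i + 1) =
      open Classical in if candidate F p.1 i ∈ F then p.2 0 else candidate F p.1 i := by
  have h1 : candidate F (splice (i + 1) p) i = candidate F p.1 i :=
    candidate_congr F fun j hj => splice_of_lt p (by omega)
  have h2 : splice (i + 1) p (i + 1) = p.2 0 := splice_add (i + 1) 0 p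
  rw [candidate, h1, h2]

theorem candidateLaw_self (hF : MeasurableSet F) (i : ℕ) :
    candidateLaw D F i F = D F ^ (i + 1) := by
  rw [candidateLaw, Measure.map_apply (measurable_candidate hF i) hF]
  induction i with
  | zero =>
    have := streamMeasure_eval_zero D hF
    simpa only [candidate, zero_add, Finset.sum_range_one, pow_zero, pow_one, mul_one] using this
  | succ i ih =>
    rw [streamMeasure_eq_prod D (i + 1) (measurable_candidate hF _ hF)]
    have : splice (i + 1) ⁻¹' ((fun y : ℕ → X => candidate F y (i + 1)) ⁻¹' F) =
        ((fun y : ℕ → X => candidate F y i) ⁻¹' F) ×ˢ ((fun y : ℕ → X => y 0) ⁻¹' F) := by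
      ext p
      simp only [Set.mem_preimage, Set.mem_prod, candidate_splice_succ]
      by_cases h : candidate F p.1 i ∈ F <;> simp [h]
    rw [this, Measure.prod_prod, ih, streamMeasure_eval_zero D hF, pow_succ _ (i + 1)]

/-- The kept point lies in `s` exactly if, for some `j ≤ i`, the first `j` draws fall into `F` and
the next one into `s`. The factor of `D s` does not depend on `s`, so statements about the law of
kept points transfer to `D`. -/
theorem candidateLaw_of_disjoint (hF : MeasurableSet F) {s : Set X} (hs : MeasurableSet s)
    (hsF : Disjoint s F) (i : ℕ) :
    candidateLaw D F i s = D s * ∑ j ∈ Finset.range (i + 1), D F ^ j := by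
  have hF' := candidateLaw_self D hF
  simp only [candidateLaw, Measure.map_apply (measurable_candidate hF _) hF] at hF'
  rw [candidateLaw, Measure.map_apply (measurable_candidate hF i) hs]
  induction i with
  | zero =>
    have := streamMeasure_eval_zero D hs
    simpa only [candidate, zero_add, Finset.sum_range_one, pow_zero, pow_one, mul_one] using this
  | succ i ih =>
    rw [streamMeasure_eq_prod D (i + 1) (measurable_candidate hF _ hs)]
    have : splice (i + 1) ⁻¹' ((fun y : ℕ → X => candidate F y (i + 1)) ⁻¹' s) =
        ((fun y : ℕ → X => candidate F y i) ⁻¹' s) ×ˢ Set.univ ∪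
        ((fun y : ℕ → X => candidate F y i) ⁻¹' F) ×ˢ ((fun y : ℕ → X => y 0) ⁻¹' s) := by
      ext p
      simp only [Set.mem_preimage, Set.mem_prod, Set.mem_union, candidate_splice_succ]
      by_cases h : candidate F p.1 i ∈ F
      · simp [h, Set.disjoint_right.1 hsF h]
      · simp [h]
    rw [this, measure_union, Measure.prod_prod, Measure.prod_prod, ih, hF',
      streamMeasure_eval_zero D hs, Finset.sum_range_succ _ (i + 1), measure_univ]
    · ring
    · rw [Set.disjoint_left]
      rintro p ⟨h1, -⟩ ⟨h2, -⟩
      exact Set.disjoint_left.1 hsF h1 h2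
    · exact (measurable_candidate hF _ hF).prod (measurable_pi_apply 0 hs)

instance (i : ℕ) : SigmaFinite (candidateLaw D F i) := by
  unfold candidateLaw; infer_instance

theorem isProbabilityMeasure_candidateLaw (hF : MeasurableSet F) (i : ℕ) :
    IsProbabilityMeasure (candidateLaw D F i) :=
  Measure.isProbabilityMeasure_map (measurable_candidate hF i).aemeasurable

theorem measurable_blocks (hF : MeasurableSet F) (L n : ℕ) :
    Measurable fun (y : ℕ → X) (j : Fin n) => candidate F (fun i => y (j * L + i)) (L - 1) :=
  measurable_pi_lambda _ fun _ => (measurable_candidate hF _).comp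
    (measurable_pi_lambda _ fun _ => measurable_pi_apply _)

/-- The points that are kept from consecutive blocks of a stream are independent. -/
theorem map_blocks (hF : MeasurableSet F) {L : ℕ} (hL : 0 < L) (n : ℕ) :
    (streamMeasure D).map
        (fun y (j : Fin n) => candidate F (fun i => y (j * L + i)) (L - 1)) =
      Measure.pi fun _ => candidateLaw D F (L - 1) := by
  refine (Measure.pi_eq fun s hs => ?_).symm
  rw [Measure.map_apply (measurable_blocks hF L n) (MeasurableSet.univ_pi hs)]
  induction n with
  | zero =>
    rw [Set.eq_univ_of_forall fun y => Set.mem_preimage.2 (Set.mem_univ_pi.2 fun j => j.elim0)]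
    simp
  | succ n ih =>
    have hmeas : MeasurableSet ((fun (y : ℕ → X) (j : Fin (n + 1)) =>
        candidate F (fun i => y (j * L + i)) (L - 1)) ⁻¹' Set.univ.pi s) :=
      measurable_blocks hF L (n + 1) (MeasurableSet.univ_pi hs)
    -- Cut off the first block; the remaining stream is again a stream of independent points.
    rw [streamMeasure_eq_prod D L hmeas]
    have : splice L ⁻¹' ((fun (y : ℕ → X) (j : Fin (n + 1)) =>
          candidate F (fun i => y (j * L + i)) (L - 1)) ⁻¹' Set.univ.pi s) =
        ((fun y : ℕ → X => candidate F y (L - 1)) ⁻¹' s 0) ×ˢ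
        ((fun (y : ℕ → X) (j : Fin n) => candidate F (fun i => y (j * L + i)) (L - 1)) ⁻¹'
          Set.univ.pi fun j => s j.succ) := by
      ext p
      simp only [Set.mem_preimage, Set.mem_pi, Set.mem_univ, true_implies, Fin.forall_fin_succ,
        Set.mem_prod]
      refine and_congr ?_ (forall_congr' fun j => ?_)
      · rw [candidate_congr F (y' := p.1)]
        intro i hi
        rw [Fin.val_zero, zero_mul, zero_add, splice_of_lt p (by omega)]
      · rw [candidate_congr F (y' := fun i => p.2 (j * L + i))]
        intro i hi
        have e : (j.succ : ℕ) * L + i = L + (j * L + i) := by simp [Fin.val_succ]; ring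
        rw [e, splice_add]
    rw [this, Measure.prod_prod, ih _ fun j => hs _, Fin.prod_univ_succ, candidateLaw,
      Measure.map_apply (measurable_candidate hF _) (hs 0)]

end Stream

/-! ### The leave-one-out bound and the yield of rejection sampling -/

section LeaveOneOut

variable {X : Type u} [MeasurableSpace X]

/-- If at most `c` out of `n + 1` points are not in the set determined by the others, then the
expected mass that is missed by the set determined by `n` independent points is at most
`c / (n + 1)`. -/
theorem lintegral_compl_le (ν : Measure X) [IsProbabilityMeasure ν] {n c : ℕ}
    (G : (Fin n → X) → Set X) (hG : MeasurableSet {p : X × (Fin n → X) | p.1 ∉ G p.2})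
    (hc : ∀ (v : Fin (n + 1) → X) (s : Finset (Fin (n + 1))),
      (∀ j ∈ s, v j ∉ G (v ∘ j.succAbove)) → s.card ≤ c) :
    (n + 1) * ∫⁻ y, ν (G y)ᶜ ∂(Measure.pi fun _ => ν) ≤ c := by
  classical
  -- By exchangeability, each coordinate is missed by the others with the same probability, namely
  -- the expected missed mass. The number of missed coordinates is at most `c` pointwise.
  have hj : ∀ j : Fin (n + 1),
      MeasurableSet {v : Fin (n + 1) → X | v j ∉ G (v ∘ j.succAbove)} ∧
      Measure.pi (fun _ => ν) {v : Fin (n + 1) → X | v j ∉ G (v ∘ j.succAbove)} =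
        ∫⁻ y, ν (G y)ᶜ ∂(Measure.pi fun _ => ν) := by
    intro j
    have hmp := measurePreserving_piFinSuccAbove (fun _ : Fin (n + 1) => ν) j
    have hset : {v : Fin (n + 1) → X | v j ∉ G (v ∘ j.succAbove)} =
        MeasurableEquiv.piFinSuccAbove (fun _ => X) j ⁻¹'
          {p : X × (Fin n → X) | p.1 ∉ G p.2} := rfl
    refine ⟨hset ▸ hmp.measurable hG, ?_⟩
    rw [hset, hmp.measure_preimage hG.nullMeasurableSet, Measure.prod_apply_symm hG]
    rfl
  have hsum : ∑ j : Fin (n + 1), Measure.pi (fun _ => ν)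
      {v : Fin (n + 1) → X | v j ∉ G (v ∘ j.succAbove)} ≤ c := by
    calc ∑ j : Fin (n + 1), Measure.pi (fun _ => ν)
          {v : Fin (n + 1) → X | v j ∉ G (v ∘ j.succAbove)}
        = ∫⁻ v, ∑ j : Fin (n + 1),
            {v : Fin (n + 1) → X | v j ∉ G (v ∘ j.succAbove)}.indicator 1 v
            ∂(Measure.pi fun _ => ν) := by
          rw [lintegral_finsetSum _ fun j _ => measurable_one.indicator (hj j).1]
          exact Finset.sum_congr rfl fun j _ => (lintegral_indicator_one (hj j).1).symm
      _ ≤ ∫⁻ v : Fin (n + 1) → X, (c : ℝ≥0∞) ∂(Measure.pi fun _ => ν) := by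
          refine lintegral_mono fun v => ?_
          have := hc v (Finset.univ.filter fun j => v j ∉ G (v ∘ j.succAbove))
            fun j hj => (Finset.mem_filter.1 hj).2
          simp only [Set.indicator_apply, Set.mem_ofPred_eq, Pi.one_apply, Finset.sum_boole]
          exact_mod_cast this
      _ = c := by simp
  calc ((n : ℝ≥0∞) + 1) * ∫⁻ y, ν (G y)ᶜ ∂(Measure.pi fun _ => ν)
      = ∑ j : Fin (n + 1), Measure.pi (fun _ => ν)
          {v : Fin (n + 1) → X | v j ∉ G (v ∘ j.succAbove)} := by
        rw [Finset.sum_congr rfl fun j _ => (hj j).2]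
        simp
    _ ≤ c := hsum

/-- The sum of a geometric series is close to its limit. -/
theorem two_thirds_le_geom_sum (D : Measure X) [IsProbabilityMeasure D] {F : Set X}
    (hF : MeasurableSet F) {ε : ℝ} (hε : 0 < ε) (hFε : ENNReal.ofReal ε < D Fᶜ) {L : ℕ}
    (hL : 2 / ε ≤ L) :
    2 / 3 ≤ D Fᶜ * ∑ j ∈ Finset.range L, D F ^ j := by
  set d := (D F).toReal with hd
  have hdF : D F = ENNReal.ofReal d := (ENNReal.ofReal_toReal (measure_ne_top D F)).symm
  have hd0 : 0 ≤ d := ENNReal.toReal_nonneg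
  have hd1 : d ≤ 1 := by
    have := ENNReal.toReal_mono ENNReal.one_ne_top (prob_le_one (μ := D) (s := F))
    simpa using this
  have hdc : D Fᶜ = ENNReal.ofReal (1 - d) := by
    rw [prob_compl_eq_one_sub hF, hdF, ← ENNReal.ofReal_one, ENNReal.ofReal_sub _ hd0]
  have hεd : ε < 1 - d := by
    rw [hdc] at hFε
    exact (ENNReal.ofReal_lt_ofReal_iff_of_nonneg hε.le).1 hFε
  -- With `d < 1 - ε ≤ exp (-ε)` and `L ≥ 2 / ε`, a block stays inside `F` with probability at most
  -- `exp (-2) ≤ 1 / 3`.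
  have hpow : d ^ L ≤ 1 / 3 := by
    have h1 : d ≤ Real.exp (-ε) := by
      have := Real.add_one_le_exp (-ε)
      linarith
    have h2 : d ^ L ≤ Real.exp (-2) := by
      refine (pow_le_pow_left₀ hd0 h1 L).trans ?_
      rw [← Real.exp_nat_mul]
      refine Real.exp_le_exp.2 ?_
      rw [div_le_iff₀ hε] at hL
      linarith
    have h3 : Real.exp (-2) ≤ 1 / 3 := by
      rw [Real.exp_neg, inv_eq_one_div]
      have := Real.add_one_le_exp (2 : ℝ)
      exact one_div_le_one_div_of_le (by norm_num) (by linarith)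
    exact h2.trans h3
  have hsum : ∑ j ∈ Finset.range L, D F ^ j =
      ENNReal.ofReal (∑ j ∈ Finset.range L, d ^ j) := by
    rw [ENNReal.ofReal_sum_of_nonneg fun j _ => pow_nonneg hd0 j]
    exact Finset.sum_congr rfl fun j _ => by rw [hdF, ENNReal.ofReal_pow hd0]
  have h23 : (2 / 3 : ℝ≥0∞) = ENNReal.ofReal (2 / 3) := by
    rw [ENNReal.ofReal_div_of_pos (by norm_num)]
    norm_num
  rw [hdc, hsum, ← ENNReal.ofReal_mul (by linarith), mul_neg_geom_sum, h23]
  exact ENNReal.ofReal_le_ofReal (by linarith)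

end LeaveOneOut

/-! ### Measurability -/

section Discrete

variable {Ω : Type*} [MeasurableSpace Ω] {ι : Type*}

/-- Partition by the value of `f`. Only attained values have to be treated, which matters because
length bounds on the lists that occur hold only for those. -/
theorem measurableSet_of_countable [Countable ι] {f : Ω → ι}
    (hf : ∀ i, MeasurableSet {ω | f ω = i}) {p : ι → Ω → Prop}
    (hp : ∀ i, (∃ ω, f ω = i) → MeasurableSet {ω | p i ω}) :
    MeasurableSet {ω | p (f ω) ω} := by
  have : {ω | p (f ω) ω} = ⋃ i, {ω | f ω = i} ∩ {ω | p i ω} := by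
    ext ω
    simp
  rw [this]
  refine MeasurableSet.iUnion fun i => ?_
  by_cases hi : ∃ ω, f ω = i
  · exact (hf i).inter (hp i hi)
  · have : {ω | f ω = i} = ∅ := Set.eq_empty_of_forall_notMem fun ω hω => hi ⟨ω, hω⟩
    rw [this, Set.empty_inter]
    exact MeasurableSet.empty

theorem measurableSet_filter {b : ι → Ω → Bool} (hb : ∀ i, MeasurableSet {ω | b i ω = true})
    (l : List ι) (s : Set (List ι)) : MeasurableSet {ω | (l.filter (b · ω)) ∈ s} := by
  induction l generalizing s with
  | nil => exact MeasurableSet.const ([] ∈ s)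
  | cons i l ih =>
    have : {ω | ((i :: l).filter (b · ω)) ∈ s} =
        ({ω | b i ω = true} ∩ {ω | (l.filter (b · ω)) ∈ {r | i :: r ∈ s}}) ∪
        ({ω | b i ω = true}ᶜ ∩ {ω | (l.filter (b · ω)) ∈ s}) := by
      ext ω
      by_cases h : b i ω = true <;> simp [h]
    rw [this]
    exact ((hb i).inter (ih _)).union ((hb i).compl.inter (ih s))

theorem measurableSet_candidates {Φ : Ω → Set ℕ} (hΦ : ∀ i, MeasurableSet {ω | i ∈ Φ ω})
    (L : ℕ) (y : ℕ → ℕ) (t : ℕ) (s : Set (List ℕ)) :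
    MeasurableSet {ω | candidates (Φ ω) L y t ∈ s} := by
  classical
  induction t generalizing s with
  | zero => exact MeasurableSet.const ([] ∈ s)
  | succ t ih =>
    by_cases hd : L ∣ t
    · simp only [candidates, if_pos hd]
      exact ih {c | c ++ [y t] ∈ s}
    · simp only [candidates, if_neg hd]
      refine measurableSet_of_countable (f := fun ω => candidates (Φ ω) L y t)
        (p := fun c ω => (if ∃ x ∈ c.getLast?, x ∈ Φ ω then c.dropLast ++ [y t] else c) ∈ s)
        (fun i => ih {i}) fun c _ => ?_
      have hA : MeasurableSet {ω | ∃ x ∈ c.getLast?, x ∈ Φ ω} := by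
        cases c.getLast? with
        | none => simp
        | some x => simpa using hΦ x
      have : {ω | (if ∃ x ∈ c.getLast?, x ∈ Φ ω then c.dropLast ++ [y t] else c) ∈ s} =
          ({ω | ∃ x ∈ c.getLast?, x ∈ Φ ω} ∩ {_ω | c.dropLast ++ [y t] ∈ s}) ∪
          ({ω | ∃ x ∈ c.getLast?, x ∈ Φ ω}ᶜ ∩ {_ω | c ∈ s}) := by
        ext ω
        rw [Set.mem_ofPred_eq]
        split_ifs with h
        · exact ⟨fun hs => Or.inl ⟨h, hs⟩, fun hs => hs.elim (·.2) fun hs => absurd h hs.1⟩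
        · exact ⟨fun hs => Or.inr ⟨h, hs⟩, fun hs => hs.elim (fun hs => absurd hs.1 h) (·.2)⟩
      rw [this]
      exact (hA.inter (MeasurableSet.const _)).union (hA.compl.inter (MeasurableSet.const _))

/-- This permits running the selection on stream positions, with `f` the stream itself. -/
theorem map_candidates {X Y : Type*} (f : Y → X) (F : Set X) (L : ℕ) (y : ℕ → Y) (t : ℕ) :
    (candidates (f ⁻¹' F) L y t).map f = candidates F L (f ∘ y) t := by
  classical
  induction t with
  | zero => rfl
  | succ t ih =>
    have hlast : (∃ x ∈ (candidates F L (f ∘ y) t).getLast?, x ∈ F) ↔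
        ∃ x ∈ (candidates (f ⁻¹' F) L y t).getLast?, x ∈ f ⁻¹' F := by
      rw [← ih, List.getLast?_map]
      simp
    rw [candidates, candidates, ← ih] at *
    simp only [hlast]
    split_ifs <;> simp [List.map_dropLast]

end Discrete

section Measurability

variable {X : Type u} [MeasurableSpace X] {Q : QueryClass.{u, v} X}
  {R : InferenceRule Q} {E : ResponseEncoding Q} (P : QueryProcedure E) (J : InferenceProcedure R E)
  {h : Q.Hyp} {a a' : Q.Answers} {N : ℕ}
  (hP : ∀ S : Fin N → X, (P.prog N).eval S [] a = E.enc _ (Q.table a' S))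
  (ham : ∀ i, Measurable (a i)) (ha' : Q.IsValid h a')

include hP ham ha'

/-- Only the answers `a` are measurable, not the reported ones `a'`. The response given by `a'` is
however decoded from the output of a computation that uses `a`. Padding needs a point, so `n = 0` is
separate. -/
theorem measurableSet_table {n : ℕ} (hn : n ≤ N) (q : Q.Table n) :
    MeasurableSet {p : Fin n → X | Q.table a' p = q} := by
  rcases Nat.eq_zero_or_pos n with rfl | h0
  · exact Subsingleton.measurableSet
  have : {p : Fin n → X | Q.table a' p = q} =
      {p | (((P.prog N).feed []).onPositions (padding N h0)).eval p [] a ∈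
        {w | ∃ q', E.decode N w = some q' ∧ Q.restrict (Fin.castLE hn) q' = q}} := by
    ext p
    have hp : (p ∘ padding N h0) ∘ Fin.castLE hn = p :=
      funext fun j => congrArg p (padding_castLE h0 hn j)
    simp only [Set.mem_ofPred_eq]
    rw [TapeComputation.eval_onPositions, TapeComputation.eval_feed, hP, E.decode_enc ha']
    simp only [Option.some.injEq, exists_eq_left']
    rw [show Q.restrict (Fin.castLE hn) (Q.table a' (p ∘ padding N h0)) = Q.table a' p from
      restrict_table p hp id]
  rw [this]
  exact TapeComputation.measurableSet_eval [] ham _ _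

include J

theorem measurableSet_infer {n : ℕ} (hn : n ≤ N) :
    MeasurableSet {p : (Fin n → X) × X | p.2 ∈ R.infer n p.1 (Q.table a' p.1)} := by
  have hsnoc : Measurable fun p : (Fin n → X) × X =>
      (Fin.snoc p.1 p.2 : Fin (n + 1) → X) := by
    refine measurable_pi_lambda _ fun i => ?_
    refine Fin.lastCases ?_ (fun i => ?_) i
    · simpa using measurable_snd
    · simpa [Function.comp_def] using (measurable_pi_apply i).comp measurable_fst
  have key : {p : (Fin n → X) × X | p.2 ∈ R.infer n p.1 (Q.table a' p.1)} =
      {p | (fun (q : Q.Table n) (p : (Fin n → X) × X) =>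
        (J.prog n).eval (Fin.snoc p.1 p.2) (E.enc n q) a ∈ {r : Option Bool | r.isSome}) (Q.table a' p.1) p} := by
    ext p
    simp only [Set.mem_ofPred_eq]
    rw [J.eval_eq ha']
    split_ifs with hx <;> simp [hx]
  rw [key]
  refine measurableSet_of_countable (f := fun p : (Fin n → X) × X => Q.table a' p.1)
    (p := fun q p => (J.prog n).eval (Fin.snoc p.1 p.2) (E.enc n q) a ∈ {r : Option Bool | r.isSome})
    (fun q => measurable_fst (measurableSet_table P hP ham ha' hn q)) fun q _ => ?_
  exact hsnoc (TapeComputation.measurableSet_eval (E.enc n q) ham _ {r : Option Bool | r.isSome})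

theorem measurableSet_label (hN : 1 ≤ N) (z : Bool) :
    MeasurableSet {x | Q.label h x = z} := by
  have hconst : Measurable fun (x : X) (_ : Fin 1) => x :=
    measurable_pi_lambda _ fun _ => measurable_id
  have key : {x | Q.label h x = z} = {x | (fun (q : Q.Table 1) (x : X) =>
      (labelProgram J id q 0).eval (fun _ => x) [] a ∈ ({z} : Set Bool))
        (Q.table a' fun _ => x) x} := by
    ext x
    simp only [Set.mem_ofPred_eq, Set.mem_singleton_iff]
    rw [eval_labelProgram (g := id) (S := fun _ => x) (fun _ => x) [] J ha' rfl]
  rw [key]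
  refine measurableSet_of_countable (f := fun x : X => Q.table a' fun _ : Fin 1 => x)
    (p := fun q x => (labelProgram J id q 0).eval (fun _ => x) [] a ∈ ({z} : Set Bool))
    (fun q => hconst (measurableSet_table P hP ham ha' hN q)) fun q _ => ?_
  exact hconst (TapeComputation.measurableSet_eval [] ham _ {z})

variable {Ω : Type*} [MeasurableSpace Ω] {ι : Type*} [Countable ι]

/-- Splitting according to which indices carry the label `z` leaves a fixed list in each piece,
where `measurableSet_infer` applies. -/
theorem measurableSet_coveredByClass (hN : 1 ≤ N) {y : ι → Ω → X} (hy : ∀ i, Measurable (y i))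
    {f : Ω → X} (hf : Measurable f) (l : List ι) (hl : l.length ≤ N) :
    MeasurableSet {ω | f ω ∈ coveredByClass R a' h (l.map (y · ω))} := by
  have hcov : ∀ l' : List ι, l'.length ≤ N →
      MeasurableSet {ω | f ω ∈ covered R a' (l'.map (y · ω))} := by
    intro l' hl'
    have hm : Measurable fun ω => ((fun i => y (l'.get i) ω : Fin l'.length → X), f ω) :=
      (measurable_pi_lambda _ fun i => hy _).prodMk hf
    have := hm (measurableSet_infer P J hP ham ha' hl')
    convert this using 1
    ext ω
    have e : l'.map (y · ω) = List.ofFn fun i => y (l'.get i) ω := by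
      conv_lhs => rw [← List.ofFn_get l']
      rw [List.map_ofFn]
      rfl
    simp only [Set.mem_ofPred_eq, Set.mem_preimage, e, covered_ofFn]
  have : {ω | f ω ∈ coveredByClass R a' h (l.map (y · ω))} = ⋃ z : Bool,
      {ω | (fun l' ω => f ω ∈ covered R a' (l'.map (y · ω)))
        (l.filter fun i => Q.label h (y i ω) = z) ω} := by
    ext ω
    simp only [coveredByClass, Set.mem_iUnion, Set.mem_ofPred_eq, List.filter_map]
    rfl
  rw [this]
  refine MeasurableSet.iUnion fun z => measurableSet_of_countable
    (f := fun ω => l.filter fun i => Q.label h (y i ω) = z)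
    (p := fun l' ω => f ω ∈ covered R a' (l'.map (y · ω))) (fun c => ?_) ?_
  · refine measurableSet_filter (b := fun i ω => decide (Q.label h (y i ω) = z))
      (fun i => ?_) l {c}
    simpa using hy i (measurableSet_label P J hP ham ha' hN z)
  · rintro _ ⟨ω, rfl⟩
    exact hcov _ ((List.length_filter_le _ _).trans hl)

theorem measurable_measure_compl (hN : 1 ≤ N) {y : ι → Ω → X} (hy : ∀ i, Measurable (y i))
    (D : Measure X) [IsProbabilityMeasure D] (l : List ι) (hl : l.length ≤ N) :
    Measurable fun ω => D (coveredByClass R a' h (l.map (y · ω)))ᶜ :=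
  measurable_measure_prodMk_left (ν := D)
    (measurableSet_coveredByClass P J hP ham ha' hN (Ω := Ω × X)
      (fun i => (hy i).comp measurable_fst) measurable_snd l hl).compl

end Measurability

/-! ### Progress in a round -/

/-- Points that are kept outside `F` halve, up to a constant factor, the mass outside `F` that is
not covered, if at most `2 k` out of `4 k + 1` points are not covered by the others. -/
theorem lintegral_candidateLaw_le {X : Type u} [MeasurableSpace X] (D : Measure X)
    [IsProbabilityMeasure D] {F : Set X} (hF : MeasurableSet F) {ε : ℝ} (hε : 0 < ε)
    (hFε : ENNReal.ofReal ε < D Fᶜ) {L : ℕ} (hL0 : 0 < L) (hL : 2 / ε ≤ L) {k : ℕ}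
    (G : (Fin (4 * k) → X) → Set X)
    (hG : MeasurableSet {p : X × (Fin (4 * k) → X) | p.1 ∉ G p.2}) (hFG : ∀ y, F ⊆ G y)
    (hc : ∀ (v : Fin (4 * k + 1) → X) (s : Finset (Fin (4 * k + 1))),
      (∀ j ∈ s, v j ∉ G (v ∘ j.succAbove)) → s.card ≤ 2 * k) :
    ∫⁻ y, D (G y)ᶜ ∂(Measure.pi fun _ => candidateLaw D F (L - 1)) ≤ 3 / 4 * D Fᶜ := by
  have := isProbabilityMeasure_candidateLaw D hF (L - 1)
  set σ := ∑ j ∈ Finset.range L, D F ^ j with hσ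
  have hGm : ∀ y, MeasurableSet (G y)ᶜ := fun y =>
    (measurable_id.prodMk measurable_const : Measurable fun x : X => (x, y)) hG
  -- What is missed lies outside `F`, where the law of kept points is `σ` times `D`.
  have hlaw : ∀ y, candidateLaw D F (L - 1) (G y)ᶜ = D (G y)ᶜ * σ := fun y => by
    rw [candidateLaw_of_disjoint D hF (hGm y)
      (Set.disjoint_compl_left_iff_subset.2 (hFG y)), Nat.sub_add_cancel hL0]
  have hσtop : σ ≠ ∞ := ENNReal.sum_ne_top.2 fun j _ => ENNReal.pow_ne_top (measure_ne_top D F)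
  have hσ0 : σ ≠ 0 := by
    intro h0
    have := two_thirds_le_geom_sum D hF hε hFε hL
    rw [← hσ, h0, mul_zero] at this
    norm_num at this
  have hmeas : Measurable fun y => D (G y)ᶜ := measurable_measure_prodMk_right hG
  have h1 := lintegral_compl_le (candidateLaw D F (L - 1)) G hG hc
  simp only [hlaw] at h1
  rw [lintegral_mul_const _ hmeas] at h1
  set I := ∫⁻ y, D (G y)ᶜ ∂(Measure.pi fun _ => candidateLaw D F (L - 1)) with hI
  -- Leave-one-out gives `(4 k + 1) I σ ≤ 2 k`. Together with `2 / 3 ≤ D Fᶜ * σ` and `1 / 2 = 3 / 4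
  -- * (2 / 3)`, the factor `σ` can be cancelled.
  have h2 : I * σ ≤ 1 / 2 := by
    have h3 : ((4 * k + 1 : ℕ) : ℝ≥0∞) * (I * σ) ≤ (4 * k + 1 : ℕ) * (1 / 2) := by
      refine le_trans (by exact_mod_cast h1) ?_
      have e : ((4 * k + 1 : ℕ) : ℝ≥0∞) * (1 / 2) = (2 * k : ℕ) + 1 / 2 := by
        have : ((4 * k + 1 : ℕ) : ℝ≥0∞) = 2 * (2 * k : ℕ) + 1 := by push_cast; ring
        rw [this, add_mul, one_mul, mul_comm (2 : ℝ≥0∞), mul_assoc, mul_one_div,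
          ENNReal.div_self (by norm_num) (by norm_num), mul_one]
      rw [e]
      exact le_self_add
    exact (ENNReal.mul_le_mul_iff_right (by simp) (ENNReal.natCast_ne_top _)).1 h3
  have h4 := two_thirds_le_geom_sum D hF hε hFε hL
  refine (ENNReal.mul_le_mul_iff_left hσ0 hσtop).1 ?_
  calc I * σ ≤ 1 / 2 := h2
    _ = 3 / 4 * (2 / 3) := by
        rw [← ENNReal.toReal_eq_toReal_iff' (by norm_num) (by
          refine ENNReal.mul_ne_top ?_ ?_ <;>
            exact ENNReal.div_ne_top (by norm_num) (by norm_num))]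
        simp only [ENNReal.toReal_mul, ENNReal.toReal_div]
        norm_num
    _ ≤ 3 / 4 * (D Fᶜ * σ) := by gcongr
    _ = 3 / 4 * D Fᶜ * σ := (mul_assoc ..).symm

section Progress

variable {X : Type u} [MeasurableSpace X] {Q : QueryClass.{u, v} X}
  {R : InferenceRule Q} {k : ℕ} {W : LosslessCompression R k} {E : ResponseEncoding Q}
  (P : QueryProcedure E) (K : CompressionProcedure W E) (J : InferenceProcedure R E)
  {h : Q.Hyp} {a a' : Q.Answers} {L : ℕ}

/-- The process is adapted: the sample before round `r` depends only on the points drawn so far,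
hence is independent of the points of that round. -/
theorem roundSample_congr {ω ω' : ℕ → X} (r : ℕ)
    (hω : ∀ i < 6 * k + r * (4 * k * L), ω i = ω' i) :
    roundSample P K J a a' h L ω r = roundSample P K J a a' h L ω' r := by
  induction r with
  | zero =>
    refine List.map_congr_left fun i hi => hω i ?_
    have := List.mem_range.1 hi
    omega
  | succ r ih =>
    have hclock : 6 * k + (r + 1) * (4 * k * L) = 6 * k + r * (4 * k * L) + 4 * k * L := by ring
    rw [roundSample, roundSample, ih fun i hi => hω i (by omega)]
    congr 1
    have hcand : ∀ (F : Set X) t, t ≤ 4 * k * L →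
        candidates F L (fun i => ω (6 * k + r * (4 * k * L) + i)) t =
          candidates F L (fun i => ω' (6 * k + r * (4 * k * L) + i)) t := by
      intro F t ht
      induction t with
      | zero => rfl
      | succ t iht =>
        rw [candidates, candidates, iht (by omega), hω _ (by omega)]
    exact hcand _ _ le_rfl

/-- The positions in the stream of the points that are selected among those at the positions
`l`. -/
noncomputable def selectedIndices (a : Q.Answers) (l : List ℕ) (ω : ℕ → X) : List ℕ :=
  chosen l.get ((updateProgram P K J (6 * k) l.length).eval (ω ∘ l.get) [] a)

theorem map_selectedIndices (l : List ℕ) (ω : ℕ → X) :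
    (selectedIndices P K J a l ω).map ω = selected P K J a (l.map ω) := by
  have h1 : selected P K J a (List.ofFn (ω ∘ l.get)) =
      chosen (ω ∘ l.get) ((updateProgram P K J (6 * k) l.length).eval (ω ∘ l.get) [] a) :=
    congrArg (fun s : Σ n, Fin n → X =>
      chosen s.2 ((updateProgram P K J (6 * k) s.1).eval s.2 [] a))
      (List.equivSigmaTuple.apply_symm_apply ⟨l.length, ω ∘ l.get⟩)
  have h2 : l.map ω = List.ofFn (ω ∘ l.get) := by
    rw [← List.map_ofFn, List.ofFn_get]
  rw [h2, h1, selectedIndices]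
  cases (updateProgram P K J (6 * k) l.length).eval (ω ∘ l.get) [] a <;> simp [chosen]

/-- The positions in the stream of the points on the query tape before the update in round `r`. -/
noncomputable def roundIndices (a a' : Q.Answers) (h : Q.Hyp) (L : ℕ) (ω : ℕ → X) : ℕ → List ℕ
  | 0 => List.range (6 * k)
  | r + 1 => selectedIndices P K J a (roundIndices a a' h L ω r) ω ++
      candidates (ω ⁻¹' coveredByClass R a' h ((roundIndices a a' h L ω r).map ω)) L
        (fun i => 6 * k + r * (4 * k * L) + i) (4 * k * L)

theorem map_roundIndices (ω : ℕ → X) (r : ℕ) :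
    (roundIndices P K J a a' h L ω r).map ω = roundSample P K J a a' h L ω r := by
  induction r with
  | zero => rfl
  | succ r ih =>
    rw [roundIndices, roundSample, List.map_append, map_selectedIndices, map_candidates, ih]
    rfl

variable (hP : ∀ S : Fin (6 * k) → X, (P.prog (6 * k)).eval S [] a = E.enc _ (Q.table a' S))
  (ham : ∀ i, Measurable (a i)) (ha' : Q.IsValid h a') (hk : 1 ≤ k) (hL : 0 < L)

include hP ha' hk hL

theorem length_roundIndices_le (ω : ℕ → X) (r : ℕ) :
    (roundIndices P K J a a' h L ω r).length ≤ 6 * k := by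
  have := (length_roundSample (ω := ω) (R := R) (W := W) P K J hP ha' hk hL r).2
  rwa [← map_roundIndices, List.length_map] at this

include ham

/-- Lists of positions are countable, so one can fix in turn the positions held before the round and
those selected; each remaining event concerns finitely many fixed coordinates of the stream. -/
theorem measurableSet_roundIndices (r : ℕ) (s : Set (List ℕ)) :
    MeasurableSet {ω | roundIndices P K J a a' h L ω r ∈ s} := by
  induction r generalizing s with
  | zero => exact MeasurableSet.const (List.range (6 * k) ∈ s)
  | succ r ih =>
    simp only [roundIndices]
    refine measurableSet_of_countable (f := fun ω => roundIndices P K J a a' h L ω r)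
      (p := fun l ω => selectedIndices P K J a l ω ++
        candidates (ω ⁻¹' coveredByClass R a' h (l.map ω)) L
        (fun i => 6 * k + r * (4 * k * L) + i) (4 * k * L) ∈ s) (fun l => ih {l}) ?_
    rintro _ ⟨ω₀, rfl⟩
    have hlen := length_roundIndices_le P K J hP ha' hk hL ω₀ r
    set l := roundIndices P K J a a' h L ω₀ r
    refine measurableSet_of_countable (f := fun ω => selectedIndices P K J a l ω)
      (p := fun l' ω => l' ++ candidates (ω ⁻¹' coveredByClass R a' h (l.map ω)) L
        (fun i => 6 * k + r * (4 * k * L) + i) (4 * k * L) ∈ s) (fun l' => ?_) fun l' _ => ?_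
    · have hm : Measurable fun (ω : ℕ → X) => ω ∘ l.get :=
        measurable_pi_lambda _ fun _ => measurable_pi_apply _
      exact hm (TapeComputation.measurableSet_eval [] ham
        (updateProgram P K J (6 * k) l.length)
        {o | chosen l.get o = l'})
    · refine measurableSet_candidates (Φ := fun ω => ω ⁻¹' coveredByClass R a' h (l.map ω))
        (fun i => ?_) L _ _ {c | l' ++ c ∈ s}
      exact measurableSet_coveredByClass P J hP ham ha' (by omega)
        (fun i => measurable_pi_apply i) (measurable_pi_apply i) l hlen

variable (D : Measure X) [IsProbabilityMeasure D]

/-- The mass that is not covered before the update in round `r`. -/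
theorem measurable_uncovered (r : ℕ) :
    Measurable fun ω => D (coveredByClass R a' h (roundSample P K J a a' h L ω r))ᶜ := by
  intro s hs
  simp only [← map_roundIndices]
  refine measurableSet_of_countable (f := fun ω => roundIndices P K J a a' h L ω r)
    (p := fun l ω => D (coveredByClass R a' h (l.map ω))ᶜ ∈ s)
    (fun l => measurableSet_roundIndices P K J hP ham ha' hk hL r {l}) ?_
  rintro _ ⟨ω₀, rfl⟩
  exact measurable_measure_compl P J hP ham ha' (by omega) (fun i => measurable_pi_apply i) D _
    (length_roundIndices_le P K J hP ha' hk hL ω₀ r) hs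

open Classical in
/-- The uncovered mass, or zero if it is at most `ε`. -/
noncomputable def excess (ε : ℝ) (t : ℝ≥0∞) : ℝ≥0∞ := if ENNReal.ofReal ε < t then t else 0

omit [MeasurableSpace X] hP ham ha' hk hL in
theorem measurable_excess (ε : ℝ) : Measurable (excess ε) :=
  Measurable.ite (measurableSet_lt measurable_const measurable_id) measurable_id measurable_const

/-- Given the past, `F` is fixed. If `D Fᶜ > ε`, the leave-one-out estimate gives the factor `3 /
4`; otherwise the uncovered mass stays at most `ε`, because coverage only grows, and both sides
vanish. -/
theorem lintegral_excess_succ_le {ε : ℝ} (hε : 0 < ε) (hLε : 2 / ε ≤ L) (r : ℕ) :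
    ∫⁻ ω, excess ε (D (coveredByClass R a' h (roundSample P K J a a' h L ω (r + 1)))ᶜ)
        ∂(streamMeasure D) ≤
      3 / 4 * ∫⁻ ω, excess ε (D (coveredByClass R a' h (roundSample P K J a a' h L ω r))ᶜ)
        ∂(streamMeasure D) := by
  set m := 6 * k + r * (4 * k * L) with hm
  have hmeas := (measurable_excess ε).comp
    (measurable_uncovered P K J hP ham ha' hk hL (W := W) D (r + 1))
  have hmeas' := (measurable_excess ε).comp
    (measurable_uncovered P K J hP ham ha' hk hL (W := W) D r)
  have hmeas'' := hmeas.comp (measurable_splice m)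
  simp only [Function.comp_def] at hmeas hmeas' hmeas''
  -- Cut the stream before the points of round `r`: the outer variable determines `F`, and the inner
  -- integral runs over fresh draws.
  rw [← (measurePreserving_splice D m).lintegral_comp hmeas,
    lintegral_prod _ hmeas''.aemeasurable,
    ← lintegral_const_mul _ hmeas']
  refine lintegral_mono fun ω => ?_
  obtain ⟨h2, h6⟩ := length_roundSample (ω := ω) (R := R) (W := W) P K J hP ha' hk hL r
  obtain ⟨A, B, -, -, -, -, -, hsel, hA, hB, -, hcov⟩ :=
    exists_selected_eq (R := R) (W := W) P K J hP ha' hk h2 h6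
  set F := coveredByClass R a' h (roundSample P K J a a' h L ω r) with hFdef
  set z := A ++ B with hz
  have hzlen : z.length ≤ 2 * k := by simp [hz]; omega
  have hFm : MeasurableSet F := by
    have h0 := measurableSet_coveredByClass P J hP ham ha' (by omega)
      (y := fun (i : Fin (roundSample P K J a a' h L ω r).length) (_ : X) =>
        (roundSample P K J a a' h L ω r).get i)
      (fun i => measurable_const) measurable_id (List.finRange _) (by simpa using h6)
    simpa only [List.map_get_finRange, id, Set.ofPred_mem_eq] using h0
  have hstep : ∀ ω' : ℕ → X, roundSample P K J a a' h L (splice m (ω, ω')) (r + 1) =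
      z ++ List.ofFn fun j : Fin (4 * k) =>
        candidate F (fun i => ω' (j * L + i)) (L - 1) := by
    intro ω'
    have h1 : roundSample P K J a a' h L (splice m (ω, ω')) r =
        roundSample P K J a a' h L ω r :=
      roundSample_congr P K J r fun i hi => splice_of_lt _ hi
    rw [roundSample, h1, hsel, ← hFdef, candidates_mul _ _ hL]
    congr 1
    rw [List.ofFn_eq_map, ← List.map_coe_finRange_eq_range, List.map_map]
    refine List.map_congr_left fun j _ => ?_
    simp only [Function.comp, ← hm, splice_add]
  simp only [hstep]
  have hy : ∀ i : Fin z.length ⊕ Fin (4 * k), Measurable fun u : Fin (4 * k) → X =>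
      Sum.elim z.get u i := by
    rintro (i | i)
    · exact measurable_const
    · exact measurable_pi_apply i
  -- The points of `z` are viewed as constant random points beside the `4 k` new ones, so that one
  -- measurability statement covers both.
  set l : List (Fin z.length ⊕ Fin (4 * k)) :=
    (List.finRange z.length).map Sum.inl ++ (List.finRange (4 * k)).map Sum.inr with hl
  have hllen : l.length ≤ 6 * k := by simp [hl]; omega
  have hlmap : ∀ u : Fin (4 * k) → X, l.map (Sum.elim z.get u ·) = z ++ List.ofFn u := by
    intro u
    rw [hl, List.map_append, List.map_map, List.map_map, List.ofFn_eq_map]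
    congr 1
    exact List.map_get_finRange z
  have hGm : MeasurableSet {p : X × (Fin (4 * k) → X) |
      p.1 ∉ coveredByClass R a' h (z ++ List.ofFn p.2)} := by
    have := measurableSet_coveredByClass P J hP ham ha' (by omega)
      (Ω := X × (Fin (4 * k) → X))
      (fun i => (hy i).comp measurable_snd) measurable_fst l hllen
    simp only [Function.comp_def, hlmap] at this
    exact this.compl
  have hφ : Measurable fun u : Fin (4 * k) → X =>
      excess ε (D (coveredByClass R a' h (z ++ List.ofFn u))ᶜ) := by
    have := measurable_measure_compl P J hP ham ha' (by omega) hy D l hllen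
    simp only [hlmap] at this
    exact (measurable_excess ε).comp this
  have hmono : ∀ u : Fin (4 * k) → X, F ⊆ coveredByClass R a' h (z ++ List.ofFn u) := by
    intro u
    rw [← hcov]
    exact coveredByClass_mono ha' (List.subset_append_left _ _)
  rw [← lintegral_map (f := fun u : Fin (4 * k) → X =>
      excess ε (D (coveredByClass R a' h (z ++ List.ofFn u))ᶜ)) hφ
      (measurable_blocks hFm L (4 * k)), map_blocks D hFm hL]
  by_cases hFε : ENNReal.ofReal ε < D Fᶜ
  · have hF : excess ε (D Fᶜ) = D Fᶜ := if_pos hFε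
    rw [hF]
    refine le_trans (lintegral_mono fun u => ?_) (lintegral_candidateLaw_le D hFm hε hFε hL hLε
      (fun u => coveredByClass R a' h (z ++ List.ofFn u)) hGm hmono fun v s hs =>
        card_not_covered_le W ha' z v s hs)
    unfold excess
    split_ifs
    · exact le_rfl
    · exact zero_le
  · refine le_of_eq_of_le ?_ zero_le
    have : ∀ u : Fin (4 * k) → X,
        excess ε (D (coveredByClass R a' h (z ++ List.ofFn u))ᶜ) = 0 := fun u =>
      if_neg fun hu => hFε (hu.trans_le (measure_mono (Set.compl_subset_compl.2 (hmono u))))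
    simp only [this, lintegral_zero]

/-- Iterate the contraction from an initial mass of at most one, then apply Markov's inequality to
the excess, which exceeds `ε` wherever it is not zero. -/
theorem streamMeasure_uncovered_le {ε : ℝ} (hε : 0 < ε) (hLε : 2 / ε ≤ L) (T : ℕ) :
    ENNReal.ofReal ε * streamMeasure D {ω | ENNReal.ofReal ε <
        D (coveredByClass R a' h (roundSample P K J a a' h L ω T))ᶜ} ≤ (3 / 4) ^ T := by
  have hint : ∀ r, ∫⁻ ω, excess ε (D (coveredByClass R a' h
      (roundSample P K J a a' h L ω r))ᶜ) ∂(streamMeasure D) ≤ (3 / 4) ^ r := by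
    intro r
    induction r with
    | zero =>
      refine (lintegral_mono (g := fun _ => 1) fun ω => ?_).trans (by simp)
      simp only [excess]
      split_ifs
      · exact prob_le_one
      · exact zero_le
    | succ r ih =>
      rw [pow_succ']
      exact (lintegral_excess_succ_le P K J hP ham ha' hk hL D hε hLε r).trans (by gcongr)
  have hmeas := (measurable_excess ε).comp
    (measurable_uncovered P K J hP ham ha' hk hL (W := W) D T)
  refine le_trans ?_ ((mul_meas_ge_le_lintegral hmeas (ENNReal.ofReal ε)).trans (hint T))
  refine mul_le_mul_of_nonneg_left (measure_mono fun ω hω => ?_) zero_le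
  simp only [Set.mem_ofPred_eq] at hω
  simp only [Set.mem_ofPred_eq, Function.comp, excess, if_pos hω]
  exact hω.le

end Progress

/-! ### Bounds -/

section Bounds

variable {ε δ : ℝ}

theorem two_thirds_le_log_two : (2 / 3 : ℝ) ≤ Real.log 2 := by
  have := Real.log_two_gt_d9
  linarith

theorem log_two_le (hε : 0 < ε) (hε1 : ε < 1) (hδ : 0 < δ) (hδ1 : δ < 1) :
    Real.log 2 ≤ Real.log (2 / (ε * δ)) := by
  have : ε * δ ≤ 1 := by nlinarith
  exact Real.log_le_log (by norm_num) (le_div_self (by norm_num) (by positivity) this)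

/-- This counts the updates, including the final one: `4 x + 2 ≤ 7 x` as soon as `x ≥ 2 / 3`, which
`log 2` satisfies. -/
theorem ceil_add_one_le {x : ℝ} (hx : 2 / 3 ≤ x) :
    (⌈4 * x⌉₊ : ℝ≥0∞) + 1 ≤ 7 * ENNReal.ofReal x := by
  have h1 := Nat.ceil_lt_add_one (a := 4 * x) (by linarith)
  have h2 : (⌈4 * x⌉₊ : ℝ≥0∞) + 1 = ENNReal.ofReal ((⌈4 * x⌉₊ : ℝ) + 1) := by
    rw [ENNReal.ofReal_add (by positivity) (by norm_num), ENNReal.ofReal_natCast,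
      ENNReal.ofReal_one]
  have h3 : (7 : ℝ≥0∞) = ENNReal.ofReal 7 := by norm_num
  rw [h2, h3, ← ENNReal.ofReal_mul (by norm_num)]
  exact ENNReal.ofReal_le_ofReal (by linarith)

/-- The number of draws in a round is of order `k / ε`; the logarithm in the stated rate is at least
`log 2` and only adds slack. -/
theorem div_le_rate (hε : 0 < ε) (hε1 : ε < 1) (hδ : 0 < δ) (hδ1 : δ < 1) {k : ℕ}
    (hk : 1 ≤ k) : k / ε ≤ 3 / 2 * (k * Real.log (2 * k / (ε * δ)) / ε) := by
  have hk1 : (1 : ℝ) ≤ k := by exact_mod_cast hk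
  have h1 : Real.log (2 / (ε * δ)) ≤ Real.log (2 * k / (ε * δ)) := by
    refine Real.log_le_log (by positivity) ?_
    gcongr
    linarith
  have h2 := log_two_le hε hε1 hδ hδ1
  have h3 := two_thirds_le_log_two
  rw [← mul_div_assoc]
  gcongr
  nlinarith

theorem natCast_le_rate (hε : 0 < ε) (hε1 : ε < 1) (hδ : 0 < δ) (hδ1 : δ < 1) {k : ℕ}
    (hk : 1 ≤ k) :
    (k : ℝ≥0∞) ≤ 2 * ENNReal.ofReal (k * Real.log (2 * k / (ε * δ)) / ε) := by
  have h1 := div_le_rate hε hε1 hδ hδ1 hk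
  have h2 : (k : ℝ) ≤ k / ε := le_div_self (by positivity) hε hε1.le
  have h3 : (2 : ℝ≥0∞) = ENNReal.ofReal 2 := by norm_num
  have h4 : (0 : ℝ) ≤ k := by positivity
  rw [h3, ← ENNReal.ofReal_mul (by norm_num), ← ENNReal.ofReal_natCast]
  exact ENNReal.ofReal_le_ofReal (by linarith)

theorem draws_le_rate (hε : 0 < ε) (hε1 : ε < 1) (hδ : 0 < δ) (hδ1 : δ < 1) {k : ℕ}
    (hk : 1 ≤ k) :
    ((4 * k * ⌈2 / ε⌉₊ : ℕ) : ℝ≥0∞) ≤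
      18 * ENNReal.ofReal (k * Real.log (2 * k / (ε * δ)) / ε) := by
  have h1 := div_le_rate hε hε1 hδ hδ1 hk
  have h2 : (⌈2 / ε⌉₊ : ℝ) ≤ 3 / ε := by
    have := (Nat.ceil_lt_add_one (a := 2 / ε) (by positivity)).le
    have h3 : 1 ≤ 1 / ε := by rw [le_div_iff₀ hε]; linarith
    calc (⌈2 / ε⌉₊ : ℝ) ≤ 2 / ε + 1 := this
      _ ≤ 2 / ε + 1 / ε := by linarith
      _ = 3 / ε := by ring
  have h3 : (18 : ℝ≥0∞) = ENNReal.ofReal 18 := by norm_num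
  rw [h3, ← ENNReal.ofReal_mul (by norm_num), ← ENNReal.ofReal_natCast]
  refine ENNReal.ofReal_le_ofReal ?_
  push_cast
  have h4 : (4 * k * ⌈2 / ε⌉₊ : ℝ) ≤ 12 * (k / ε) := by
    calc (4 * k * ⌈2 / ε⌉₊ : ℝ) ≤ 4 * k * (3 / ε) := by gcongr
      _ = 12 * (k / ε) := by ring
  linarith

/-- The constant `4` comes from `3 / 4 ≤ exp (-1 / 4)`; the `2` under the logarithm makes the
inequality strict. -/
theorem pow_lt_of_ceil (hε : 0 < ε) (hδ : 0 < δ) :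
    (3 / 4 : ℝ≥0∞) ^ ⌈4 * Real.log (2 / (ε * δ))⌉₊ < ENNReal.ofReal ε * ENNReal.ofReal δ := by
  set T := ⌈4 * Real.log (2 / (ε * δ))⌉₊
  have h1 : 4 * Real.log (2 / (ε * δ)) ≤ T := Nat.le_ceil _
  have h2 : (3 / 4 : ℝ) ^ T ≤ ε * δ / 2 := by
    have h3 : (3 / 4 : ℝ) ≤ Real.exp (-(1 / 4)) := by
      have := Real.add_one_le_exp (-(1 / 4) : ℝ)
      linarith
    calc (3 / 4 : ℝ) ^ T ≤ Real.exp (-(1 / 4)) ^ T := pow_le_pow_left₀ (by norm_num) h3 T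
      _ = Real.exp (T * -(1 / 4)) := (Real.exp_nat_mul _ _).symm
      _ ≤ Real.exp (-Real.log (2 / (ε * δ))) := Real.exp_le_exp.2 (by linarith)
      _ = ε * δ / 2 := by rw [Real.exp_neg, Real.exp_log (by positivity), inv_div]
  have h4 : (3 / 4 : ℝ≥0∞) = ENNReal.ofReal (3 / 4) := by
    rw [ENNReal.ofReal_div_of_pos (by norm_num)]
    norm_num
  have h5 : 0 < ε * δ := by positivity
  rw [h4, ← ENNReal.ofReal_pow (by norm_num), ← ENNReal.ofReal_mul hε.le]
  exact (ENNReal.ofReal_lt_ofReal_iff h5).2 (by linarith)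

/-- The time of all steps, in terms of the times of the procedures. -/
theorem total_time_le {κ j ρ lam tP tC b M τ : ℝ≥0∞} (hκ : 1 ≤ κ) (hj : 1 ≤ j) (hκρ : κ ≤ 2 * ρ)
    (hM : M ≤ 18 * ρ) (hτ : τ + 1 ≤ 7 * lam) (hlam : 1 ≤ 2 * lam) (hb : b ≤ tP) :
    2 * (6 * κ) + τ * (tP + (6 * κ * (j + 2) + 2 * tC + 4) + 1 + (4 * b + 12 * κ + 1) +
        M * (2 * j + 4)) + (tP + (6 * κ * (j + 2) + 2 * tC + 4) + 1 + (4 * b + 12 * κ + 1)) + 1 ≤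
      1400 * lam * (tP + tC + ρ * j) := by
  have hκj : 1 ≤ κ * j := one_le_mul hκ hj
  have hκκj : κ ≤ κ * j := le_mul_of_one_le_right zero_le hj
  have hρ : κ * j ≤ 2 * (ρ * j) := by
    rw [← mul_assoc]
    gcongr
  set u := tP + (6 * κ * (j + 2) + 2 * tC + 4) + 1 + (4 * b + 12 * κ + 1) with hu
  have hU : u ≤ 5 * tP + 2 * tC + 72 * (ρ * j) := by
    calc u ≤ tP + (6 * κ * (j + 2 * j) + 2 * tC + 4 * (κ * j)) + κ * j +
          (4 * tP + 12 * (κ * j) + κ * j) := by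
          rw [hu]
          gcongr
          · exact le_mul_of_one_le_right zero_le hj
          · exact le_mul_of_one_le_right zero_le hκj
      _ = 5 * tP + 2 * tC + 36 * (κ * j) := by ring
      _ ≤ 5 * tP + 2 * tC + 36 * (2 * (ρ * j)) := by gcongr
      _ = 5 * tP + 2 * tC + 72 * (ρ * j) := by ring
  have hD : M * (2 * j + 4) ≤ 108 * (ρ * j) := by
    calc M * (2 * j + 4) ≤ 18 * ρ * (2 * j + 4 * j) := by
          gcongr
          exact le_mul_of_one_le_right zero_le hj
      _ = 108 * (ρ * j) := by ring
  calc 2 * (6 * κ) + τ * (u + M * (2 * j + 4)) + u + 1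
      ≤ 12 * (κ * j) + τ * (u + M * (2 * j + 4)) + (u + M * (2 * j + 4)) + κ * j := by
        rw [← mul_assoc, show (2 : ℝ≥0∞) * 6 = 12 by norm_num]
        gcongr
        exact le_self_add
    _ = (τ + 1) * (u + M * (2 * j + 4)) + 13 * (κ * j) * 1 := by ring
    -- The initial draws and the halting step lack a logarithmic factor, which `1 ≤ 2 * lam`
    -- supplies.
    _ ≤ 7 * lam * (5 * tP + 2 * tC + 72 * (ρ * j) + 108 * (ρ * j)) +
        13 * (2 * (ρ * j)) * (2 * lam) := by gcongr
    _ = 35 * (lam * tP) + 14 * (lam * tC) + 1312 * (lam * (ρ * j)) := by ring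
    _ ≤ 1400 * (lam * tP) + 1400 * (lam * tC) + 1400 * (lam * (ρ * j)) := by
        gcongr <;> norm_num
    _ = 1400 * lam * (tP + tC + ρ * j) := by ring

end Bounds

/-! ### The bounded memory learning theorem -/

theorem mainTheorem1 :
    ∃ C : ℝ, 0 < C ∧
      ∀ (X : Type u) [MeasurableSpace X] (Q : QueryClass.{u, v} X) (R : InferenceRule Q)
        (k : ℕ) (_ : 1 ≤ k) (W : LosslessCompression R k) (E : ResponseEncoding Q)
        (cost : CostModel X) (P : QueryProcedure E) (K : CompressionProcedure W E)
        (J : InferenceProcedure R E) (ε δ : ℝ), 0 < ε → ε < 1 → 0 < δ → δ < 1 →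
      ∃ A : Learner Q, A.IsRPULearner cost ε δ ∧
        ∀ (h : Q.Hyp) (a : Q.Answers), Q.IsValid h a → ∀ ω : ℕ → X,
          ((A.final cost a ω).queries : ℝ≥0∞) ≤
            ENNReal.ofReal (C * Real.log (2 / (ε * δ))) * P.numQueries (6 * k) ∧
          (A.final cost a ω).peakPoints ≤ 7 * k ∧
          ((A.final cost a ω).peakBits : ℝ) ≤ C * E.maxBits (7 * k) ∧
          (A.final cost a ω).time ≤
            ENNReal.ofReal (C * Real.log (2 / (ε * δ))) *
              (P.worstTime cost (7 * k) + K.worstTime cost (7 * k) +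
                ENNReal.ofReal (k * Real.log (2 * k / (ε * δ)) / ε) * J.worstTime cost k) := by
  refine ⟨1400, by norm_num, ?_⟩
  intro X _ Q R k hk W E cost P K J ε δ hε hε1 hδ hδ1
  set L := ⌈2 / ε⌉₊
  set T := ⌈4 * Real.log (2 / (ε * δ))⌉₊
  have hL : 0 < L := Nat.ceil_pos.2 (by positivity)
  refine ⟨rpuLearner P K J L T, ?_, ?_⟩
  · intro h a ha
    -- The choice `a'` depends on `h` and `a` but not on the stream, so one choice serves for all
    -- rounds and all `ω`.
    obtain ⟨a', ha', hP⟩ := P.correct (6 * k) h a ha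
    have hout := fun ω => rpuLearner_outcome (ω := ω) (T := T) P K J cost hP ha ha' hk hL
    refine ⟨fun ω => (hout ω).1, fun ω x z hz => ?_, fun ham D hD => ?_⟩
    · rw [(hout ω).2.1 x] at hz
      split_ifs at hz
      exact (Option.some.inj hz).symm
    · have hset : ∀ ω, {x | (rpuLearner P K J L T).classifier cost a ω x = none} =
          (coveredByClass R a' h (roundSample P K J a a' h L ω T))ᶜ := by
        intro ω
        ext x
        simp [(hout ω).2.1 x]
      simp only [hset]
      have h1 := streamMeasure_uncovered_le P K J hP ham ha' hk hL D hε (Nat.le_ceil _) T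
      exact lt_of_mul_lt_mul_left' (h1.trans_lt (pow_lt_of_ceil hε hδ))
  · intro h a ha ω
    obtain ⟨a', ha', hP⟩ := P.correct (6 * k) h a ha
    obtain ⟨-, -, h3, h4, h5, h6⟩ :=
      rpuLearner_outcome (ω := ω) (T := T) P K J cost hP ha ha' hk hL
    have hlog := two_thirds_le_log_two.trans (log_two_le hε hε1 hδ hδ1)
    have hT := ceil_add_one_le hlog
    have hC : ENNReal.ofReal (1400 * Real.log (2 / (ε * δ))) =
        1400 * ENNReal.ofReal (Real.log (2 / (ε * δ))) := by
      rw [ENNReal.ofReal_mul (by norm_num)]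
      norm_num
    refine ⟨h6.trans ?_, h3, ?_, h5.trans ?_⟩
    · rw [hC]
      calc (T : ℝ≥0∞) * P.numQueries (6 * k) + P.numQueries (6 * k)
          = (T + 1) * P.numQueries (6 * k) := by ring
        _ ≤ 7 * ENNReal.ofReal (Real.log (2 / (ε * δ))) * P.numQueries (6 * k) := by gcongr
        _ ≤ 1400 * ENNReal.ofReal (Real.log (2 / (ε * δ))) * P.numQueries (6 * k) := by
          gcongr
          norm_num
    · have h7 : (((rpuLearner P K J L T).final cost a ω).peakBits : ℝ) ≤
          (2 * E.maxBits (7 * k) : ℕ) := by exact_mod_cast h4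
      push_cast at h7
      have h8 : (0 : ℝ) ≤ E.maxBits (7 * k) := by positivity
      linarith
    · rw [hC]
      -- Even on the empty sample, returning costs one unit; this lets the inference time absorb
      -- additive constants.
      have hj : 1 ≤ J.worstTime cost k :=
        (TapeComputation.one_le_time ..).trans
          (J.time_le cost (Nat.zero_le k) ha (a := a) Fin.elim0 (ω 0))
      have hlam : 1 ≤ 2 * ENNReal.ofReal (Real.log (2 / (ε * δ))) := by
        rw [← ENNReal.ofReal_ofNat, ← ENNReal.ofReal_mul (by norm_num), ENNReal.one_le_ofReal]
        linarith
      have := total_time_le (tC := K.worstTime cost (7 * k))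
        (by exact_mod_cast hk : (1 : ℝ≥0∞) ≤ k) hj (natCast_le_rate hε hε1 hδ hδ1 hk)
        (draws_le_rate hε hε1 hδ hδ1 hk) hT hlam (P.maxBits_le cost (n := 7 * k) ha (ω 0))
      simp only [updateCost, testCost]
      push_cast at this ⊢
      exact this
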